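/- **Model.** Base stations (BSs) form a homogeneous Poisson point process $\Phi$ of density $\lambda>0$ in the plane; the typical user sits at the origin; user density is $\rho>0$. The active BSs form a homogeneous Poisson process $\tilde\Phi\subseteq\Phi$ of density $\tilde\lambda=\lambda\bigl[1-(1+\frac{\rho}{q\lambda})^{-q}\bigr]$, where $q>0$ is a constant (the coupling of $\tilde\Phi$ with $\Phi$ is otherwise arbitrary). Let $L>0$ be the antenna height difference; a BS at 2D distance $r$ has 3D distance $w=\sqrt{r^2+L^2}$. There are cut-off distances $L<d_1<\dots<d_{N-1}$ ($N\ge1$) that split $[L,\infty)$ into the pieces $[L,d_1],(d_1,d_2],\dots,(d_{N-1},\infty)$. Given the positions and the activity of the BSs, the links to the typical user are independent; a link with $w$ in the $n$-th piece is line-of-sight (LoS) with probability $\mathrm{Pr}^{\rm L}(w)=\mathrm{Pr}^{\rm L}_n(w)\in[0,1]$ and then has path loss $\zeta^{\rm L}(w)=\zeta^{\rm L}_n(w)=A^{\rm L}_nw^{-\alpha^{\rm L}_n}$, and is non-line-of-sight (NLoS) otherwise, with path loss $\zeta^{\rm NL}(w)=\zeta^{\rm NL}_n(w)=A^{\rm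 NL}_nw^{-\alpha^{\rm NL}_n}$; all $A$'s and $\alpha$'s are positive and each $\mathrm{Pr}^{\rm L}_n$ is decreasing on its piece. Links have i.i.d. fading gains, exponential with mean one, independent of everything else. Assume that $\mathrm{Pr}^{\rm L}_1(w)>0$ for some $w>L$ in the first piece, and that no link is stronger than a first-piece LoS link at distance $L$: $\zeta^{\rm L}(w)\le\zeta^{\rm L}_1(L)$ and $\zeta^{\rm NL}(w)\le\zeta^{\rm L}_1(L)$ for all $w\ge L$. The typical user is served by the BS $b_o\in\Phi$ with the largest path-loss value $\zeta$ (maximum average received power). With transmission power $P>0$, noise power $P_{\rm N}\ge0$, fading gain $h$ of the serving link, and fading gain $g_i$ and path loss $\beta_i$ of the link from BS $b_i$, let $I_{\rm agg}=\sum_{b_i\in\tilde\Phi\setminus b_o}P\beta_ig_i$, $\mathrm{SINR}=P\zeta h/(I_{\rm agg}+P_{\rm N})$ with $\zeta$ the path loss of the serving link, $\mathscr L_{I_{\rm agg}}(s)=\mathbb E[e^{-sI_{\rm agg}}]$, and $p^{\rm cov}(\lambda,\rho,\gamma)=\Pr[\mathrm{SINR}>\gamma]$ for a threshold $\gamma>0$.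 **Theorem.** Put $s=\frac{\gamma}{P\zeta^{\rm L}_1(L)}$. Then $\lim_{\lambda\to\infty}\tilde\lambda=\rho$, all the following limits exist, and $$\lim_{\lambda\to\infty}p^{\rm cov}(\lambda,\rho,\gamma)=\lim_{\lambda\to\infty}\Pr\Bigl[\frac{P\zeta^{\rm L}_1(L)h}{I_{\rm agg}+P_{\rm N}}>\gamma\Bigr]=\exp\Bigl(-\frac{P_{\rm N}\gamma}{P\zeta^{\rm L}_1(L)}\Bigr)\lim_{\lambda\to\infty}\mathscr L_{I_{\rm agg}}(s),$$ where $$\lim_{\lambda\to\infty}\mathscr L_{I_{\rm agg}}(s)=\exp\Bigl(-2\pi\rho\int_0^\infty\frac{\mathrm{Pr}^{\rm L}(\sqrt{u^2+L^2})\,u}{1+\bigl(sP\zeta^{\rm L}(\sqrt{u^2+L^2})\bigr)^{-1}}du\Bigr)\exp\Bigl(-2\pi\rho\int_0^\infty\frac{\bigl[1-\mathrm{Pr}^{\rm L}(\sqrt{u^2+L^2})\bigr]u}{1+\bigl(sP\zeta^{\rm NL}(\sqrt{u^2+L^2})\bigr)^{-1}}du\Bigr),$$ with $e^{-\infty}=0$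 if an integral diverges (then $I_{\rm agg}=\infty$ almost surely and $\mathrm{SINR}=0$). -/

import Mathlib

open MeasureTheory ProbabilityTheory Filter Topology Set
open scoped ENNReal NNReal

noncomputable section

namespace UDN

/-- The plane in which base stations (BSs) are deployed; the typical user (UE) is at the origin. -/
abbrev Plane : Type := EuclideanSpace ℝ (Fin 2)

/-- The multi-piece LoS/NLoS path-loss model with `k + 1` pieces separated by the `k` cut-off
distances `d 0 < ⋯ < d (k-1)`. Pieces are numbered from `0`: the first piece is piece `0`.
`L` is the BS-to-UE antenna height difference. -/
structure PathLoss (k : ℕ) where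
  /-- antenna height difference -/
  L : ℝ
  /-- cut-off distances -/
  d : Fin k → ℝ
  /-- LoS path losses at reference distance `1` -/
  AL : Fin (k + 1) → ℝ
  /-- NLoS path losses at reference distance `1` -/
  ANL : Fin (k + 1) → ℝ
  /-- LoS path-loss exponents -/
  aL : Fin (k + 1) → ℝ
  /-- NLoS path-loss exponents -/
  aNL : Fin (k + 1) → ℝ
  /-- LoS probability functions of the pieces -/
  prL : Fin (k + 1) → ℝ → ℝ

namespace PathLoss

variable {k : ℕ} (M : PathLoss k)

/-- The piece to which the 3D distance `w` belongs: the number of cut-off distances that are `< w`,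
so piece `0` is `w ≤ d 0`, piece `n` is `d (n-1) < w ≤ d n`, and piece `k` is `d (k-1) < w`. -/
def piece (w : ℝ) : Fin (k + 1) :=
  ⟨(Finset.univ.filter fun n : Fin k => M.d n < w).card,
    Nat.lt_succ_of_le ((Finset.card_le_univ _).trans (Fintype.card_fin k).le)⟩

/-- The LoS path-loss function of the `n`-th piece. -/
def zetaPieceL (n : Fin (k + 1)) (w : ℝ) : ℝ := M.AL n * w ^ (-(M.aL n))

/-- The NLoS path-loss function of the `n`-th piece. -/
def zetaPieceNL (n : Fin (k + 1)) (w : ℝ) : ℝ := M.ANL n * w ^ (-(M.aNL n))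

/-- The stacked (piecewise) LoS path-loss function. -/
def zetaL (w : ℝ) : ℝ := M.zetaPieceL (M.piece w) w

/-- The stacked (piecewise) NLoS path-loss function. -/
def zetaNL (w : ℝ) : ℝ := M.zetaPieceNL (M.piece w) w

/-- The stacked (piecewise) LoS probability function. -/
def PrL (w : ℝ) : ℝ := M.prL (M.piece w) w

/-- The 3D distance of a link with 2D distance `r`. -/
def dist3 (r : ℝ) : ℝ := Real.sqrt (r ^ 2 + M.L ^ 2)

/-- The standing assumptions on the parameters of the path-loss model. -/
structure Valid : Prop where
  L_pos : 0 < M.L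
  d_strictMono : StrictMono M.d
  /-- the first piece `[L, d 0]` is a non-degenerate interval -/
  L_lt_d : ∀ n, M.L < M.d n
  AL_pos : ∀ n, 0 < M.AL n
  ANL_pos : ∀ n, 0 < M.ANL n
  aL_pos : ∀ n, 0 < M.aL n
  aNL_pos : ∀ n, 0 < M.aNL n
  /-- each LoS probability function is a probability on its piece ... -/
  prL_mem : ∀ n w, M.L ≤ w → M.piece w = n → M.prL n w ∈ Icc (0 : ℝ) 1
  /-- ... and monotonically decreasing there -/
  prL_anti : ∀ n, AntitoneOn (M.prL n) {w | M.L ≤ w ∧ M.piece w = n}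

end PathLoss

/-- `N B ω` is the number of points in `B` of a random point configuration. The configuration is a
homogeneous Poisson point process in the plane with density `lam`: the number of points in a
bounded Borel set is Poisson distributed with mean `lam` times the area, and the numbers of points
in finitely many pairwise disjoint bounded Borel sets are independent. -/
structure IsHPPP {Ω : Type*} [MeasurableSpace Ω] (N : Set Plane → Ω → ℕ∞) (lam : ℝ)
    (μ : Measure Ω) : Prop where
  law : ∀ B : Set Plane, MeasurableSet B → Bornology.IsBounded B →
    HasLaw (N B) ((poissonMeasure (lam * volume.real B).toNNReal).map (fun n : ℕ => (n : ℕ∞))) μ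
  indep : ∀ (m : ℕ) (B : Fin m → Set Plane), (∀ j, MeasurableSet (B j)) →
    (∀ j, Bornology.IsBounded (B j)) → Pairwise (fun i j => Disjoint (B i) (B j)) →
    iIndepFun (fun j => N (B j)) μ

/-- The random objects of the downlink network: for the `i`-th BS, its position `X i`, whether it is
active, the variable `U i` which decides whether its link to the typical UE is LoS, and the
multi-path fading gain `h i` of that link. -/
structure Network (Ω : Type*) where
  X : ℕ → Ω → Plane
  active : ℕ → Ω → Prop
  U : ℕ → Ω → ℝ
  h : ℕ → Ω → ℝ

/-- The density of active BSs for BS density `lam` and UE density `rho`. -/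
def activeDensity (q rho lam : ℝ) : ℝ := lam * (1 - 1 / (1 + rho / (q * lam)) ^ q)

/-- `exp (-x)` for `x ∈ [0, ∞]`, with `exp (-∞) = 0`. -/
def expNeg (x : ℝ≥0∞) : ℝ := if x = ∞ then 0 else Real.exp (-x.toReal)

namespace Network

variable {Ω : Type*} (S : Network Ω)

/-- The number of BSs in `B`. -/
def count (B : Set Plane) (ω : Ω) : ℕ∞ := {i : ℕ | S.X i ω ∈ B}.encard

/-- The number of active BSs in `B`. -/
def activeCount (B : Set Plane) (ω : Ω) : ℕ∞ := {i : ℕ | S.active i ω ∧ S.X i ω ∈ B}.encard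

/-- The probabilistic model: the BSs form a homogeneous Poisson process of density `lam`, the active
BSs form a homogeneous Poisson process of density `activeDensity q rho lam`, and the marks of the
links to the typical UE are i.i.d. and independent of the BS deployment and of the BS activity:
`U i` is uniform on `[0, 1]` and `h i` is exponential with mean one, independent of `U i`.
How activity depends on the deployment is not restricted. -/
structure Valid [MeasurableSpace Ω] (μ : Measure Ω) (q rho lam : ℝ) : Prop where
  measurable_X : ∀ i, Measurable (S.X i)
  measurable_active : ∀ i, Measurable (S.active i)
  measurable_U : ∀ i, Measurable (S.U i)
  measurable_h : ∀ i, Measurable (S.h i)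
  hppp : IsHPPP S.count lam μ
  hppp_active : IsHPPP S.activeCount (activeDensity q rho lam) μ
  law_mark : ∀ i, HasLaw (fun ω => (S.U i ω, S.h i ω))
    ((volume.restrict (Icc (0 : ℝ) 1)).prod (expMeasure 1)) μ
  indep_mark : iIndepFun (fun i ω => (S.U i ω, S.h i ω)) μ
  indep_deployment : IndepFun (fun ω i => (S.X i ω, S.active i ω))
    (fun ω i => (S.U i ω, S.h i ω)) μ

variable {k : ℕ} (M : PathLoss k)

/-- The 3D distance between the `i`-th BS and the typical UE. -/
def w (i : ℕ) (ω : Ω) : ℝ := M.dist3 ‖S.X i ω‖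

open Classical in
/-- The path loss of the link from the `i`-th BS to the typical UE: given its 3D distance, the link
is LoS with the LoS probability at that distance, and NLoS otherwise. -/
def pathLoss (i : ℕ) (ω : Ω) : ℝ :=
  if S.U i ω < M.PrL (S.w M i ω) then M.zetaL (S.w M i ω) else M.zetaNL (S.w M i ω)

/-- The BS serving the typical UE: the one with the maximum average received power, i.e. with the
largest path-loss value (ties, which have probability zero, are broken by the smallest index). -/
def serving (ω : Ω) : ℕ := sInf {i : ℕ | ∀ j, S.pathLoss M j ω ≤ S.pathLoss M i ω}

open Classical in
/-- The aggregate interference at the typical UE: the sum over all active BSs other than the serving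
BS of the received powers, for BS transmission power `P`. -/
def interference (P : ℝ) (ω : Ω) : ℝ≥0∞ :=
  ∑' i : ℕ, if S.active i ω ∧ i ≠ S.serving M ω then
    ENNReal.ofReal (P * S.pathLoss M i ω * S.h i ω) else 0

/-- The SINR of the typical UE when the path loss of its serving link is `z`. -/
def sinrWith (P PN z : ℝ) (ω : Ω) : ℝ≥0∞ :=
  ENNReal.ofReal (P * z * S.h (S.serving M ω) ω) / (S.interference M P ω + ENNReal.ofReal PN)

/-- The SINR of the typical UE. -/
def sinr (P PN : ℝ) (ω : Ω) : ℝ≥0∞ :=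
  S.sinrWith M P PN (S.pathLoss M (S.serving M ω) ω) ω

/-- The coverage probability at SINR threshold `g`. -/
def pcov [MeasurableSpace Ω] (μ : Measure Ω) (P PN g : ℝ) : ℝ :=
  μ.real {ω | ENNReal.ofReal g < S.sinr M P PN ω}

/-- The Laplace transform `E [exp (-s I)]` of the aggregate interference. -/
def laplace [MeasurableSpace Ω] (μ : Measure Ω) (P s : ℝ) : ℝ :=
  ∫ ω, expNeg (ENNReal.ofReal s * S.interference M P ω) ∂μ

end Network

namespace PathLoss

variable {k : ℕ} (M : PathLoss k)

/-- The integral over the LoS interferers, with values in `[0, ∞]`. -/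
def integralL (P s : ℝ) : ℝ≥0∞ :=
  ∫⁻ u in Ioi (0 : ℝ), ENNReal.ofReal
    (M.PrL (M.dist3 u) * u / (1 + (s * P * M.zetaL (M.dist3 u))⁻¹))

/-- The integral over the NLoS interferers, with values in `[0, ∞]`. -/
def integralNL (P s : ℝ) : ℝ≥0∞ :=
  ∫⁻ u in Ioi (0 : ℝ), ENNReal.ofReal
    ((1 - M.PrL (M.dist3 u)) * u / (1 + (s * P * M.zetaNL (M.dist3 u))⁻¹))

/-- The limiting Laplace transform of the aggregate interference. -/
def limitLaplace (P rho s : ℝ) : ℝ :=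
  expNeg (ENNReal.ofReal (2 * Real.pi * rho) * M.integralL P s) *
    expNeg (ENNReal.ofReal (2 * Real.pi * rho) * M.integralNL P s)

end PathLoss

end UDN

end

/-! The Laplace transform of the power from all active BSs, the serving one included, is known
exactly at every density. It is the Laplace functional of an independently marked Poisson process
(`lintegral_nexp_marked`, `Network.Valid.lintegral_nexp_totalPower`). It depends on the BS density
only through the active density, which tends to `rho`, so its limit is immediate.

Interference differs from total power only when the serving BS is active, and this becomes unlikely.
Fix `z` slightly below the largest path loss ζ. In a dense network some link reaches `z` with
probability close to one (`tendsto_measure_no_strong_link`). The serving BS then lies in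
`strongRegion z`, whose area tends to zero as `z` increases to ζ: in the limit only finitely many
circles remain (`exists_volume_strongRegion_le`). The active density stays bounded, so the
probability of any active BS in that region is small (`measure_exists_active_le`). Only this union
bound is used, so the coupling between activity and deployment plays no role.

The serving index is a function of positions and LoS variables alone. Conditionally on these, its
fading gain is exponential and independent of the interference, which omits it. Coverage with a
deterministic serving path loss is therefore an expectation of `nexp` (`measure_lt_sinrWith`), and
noise factors out. The true path loss lies between `z` and ζ outside a rare event. Replacing ζ by
`z` costs at most `ζ / z - 1`, uniformly in the interference (`nexp_le_nexp_mul_add`), which gives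
the limit of the coverage probability.

Expectations are computed as integrals in `[0, ∞]`, with `nexp ∞ = 0`, so divergent interference is
included from the start; real numbers return only at the end. -/

namespace UDN

/-! ### The exponential on `[0, ∞]` and series of independent variables -/

/-- `exp (-x)` as a function from `[0, ∞]` to itself. -/
noncomputable def nexp (x : ℝ≥0∞) : ℝ≥0∞ := EReal.exp (-(x : EReal))

/-- The inverse of `nexp` on `[0, 1]`. -/
noncomputable def nlog (p : ℝ≥0∞) : ℝ≥0∞ := (-(ENNReal.log p)).toENNReal

lemma nexp_zero : nexp 0 = 1 := by simp [nexp]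

lemma nexp_top : nexp ∞ = 0 := by simp [nexp]

lemma nexp_coe_real (x : ℝ) (hx : 0 ≤ x) : nexp (ENNReal.ofReal x) = ENNReal.ofReal (Real.exp (-x)) := by
  rw [nexp, EReal.coe_ennreal_ofReal, max_eq_left hx, ← EReal.coe_neg, EReal.exp_coe]

lemma nexp_add (x y : ℝ≥0∞) : nexp (x + y) = nexp x * nexp y := by
  rw [nexp, nexp, nexp, EReal.coe_ennreal_add, ← EReal.exp_add, EReal.neg_add, sub_eq_add_neg]
  · left; exact EReal.coe_ennreal_ne_bot x
  · right; exact EReal.coe_ennreal_ne_bot y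

lemma nexp_sum {ι : Type*} (s : Finset ι) (f : ι → ℝ≥0∞) :
    nexp (∑ i ∈ s, f i) = ∏ i ∈ s, nexp (f i) := by
  classical
  induction s using Finset.induction_on with
  | empty => simp [nexp_zero]
  | insert a s ha ih => rw [Finset.sum_insert ha, Finset.prod_insert ha, nexp_add, ih]

lemma nexp_nsmul (n : ℕ) (x : ℝ≥0∞) : nexp (n * x) = nexp x ^ n := by
  induction n with
  | zero => simp [nexp_zero]
  | succ n ih => rw [Nat.cast_succ, add_mul, one_mul, nexp_add, ih, pow_succ]

lemma antitone_nexp : Antitone nexp := fun x y h => by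
  rw [nexp, nexp, EReal.exp_le_exp_iff, EReal.neg_le_neg_iff]
  exact EReal.coe_ennreal_le_coe_ennreal_iff.2 h

lemma nexp_le_one (x : ℝ≥0∞) : nexp x ≤ 1 := nexp_zero ▸ antitone_nexp (zero_le (a := x))

lemma nexp_ne_top (x : ℝ≥0∞) : nexp x ≠ ∞ := ((nexp_le_one x).trans_lt ENNReal.one_lt_top).ne

lemma continuous_nexp : Continuous nexp :=
  ENNReal.continuous_exp.comp (continuous_neg.comp continuous_coe_ennreal_ereal)

lemma measurable_nexp : Measurable nexp := continuous_nexp.measurable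

lemma nexp_nlog {p : ℝ≥0∞} (hp : p ≤ 1) : nexp (nlog p) = p := by
  have h : (0 : EReal) ≤ -ENNReal.log p := by
    rw [EReal.le_neg, neg_zero]
    exact ENNReal.log_le_zero_iff.2 hp
  rw [nexp, nlog, EReal.coe_toENNReal h, neg_neg, ENNReal.exp_log]

lemma measurable_nlog : Measurable nlog :=
  measurable_ereal_toENNReal.comp
    (continuous_neg.measurable.comp ENNReal.measurable_log)

lemma expNeg_eq (x : ℝ≥0∞) : expNeg x = (nexp x).toReal := by
  rw [expNeg]
  split_ifs with h
  · simp [h, nexp_top]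
  · rw [← ENNReal.ofReal_toReal h, nexp_coe_real _ ENNReal.toReal_nonneg,
      ENNReal.toReal_ofReal (Real.exp_pos _).le, ENNReal.toReal_ofReal ENNReal.toReal_nonneg]

/-- The Laplace transform of a series of independent nonnegative random variables. -/
lemma lintegral_nexp_tsum {Ω β : Type*} [MeasurableSpace Ω] [MeasurableSpace β] {μ : Measure Ω}
    {m : ℕ → Ω → β} (hm : ∀ i, Measurable (m i)) (hind : iIndepFun m μ) {F : ℕ → β → ℝ≥0∞}
    (hF : ∀ i, Measurable (F i)) {f : ℕ → ℝ≥0∞}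
    (hf : ∀ i, nexp (f i) = ∫⁻ ω, nexp (F i (m i ω)) ∂μ) :
    ∫⁻ ω, nexp (∑' i, F i (m i ω)) ∂μ = nexp (∑' i, f i) := by
  have := hind.isProbabilityMeasure
  have hfin : ∀ n : ℕ, ∫⁻ ω, nexp (∑ i ∈ Finset.range n, F i (m i ω)) ∂μ
      = nexp (∑ i ∈ Finset.range n, f i) := by
    intro n
    simp_rw [nexp_sum, hf]
    exact lintegral_prod_eq_prod_lintegral_of_indepFun _ (fun i ω => nexp (F i (m i ω)))
      (hind.comp (fun i x => nexp (F i x)) fun i => measurable_nexp.comp (hF i))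
      fun i => measurable_nexp.comp ((hF i).comp (hm i))
  have h1 : Tendsto (fun n : ℕ => ∫⁻ ω, nexp (∑ i ∈ Finset.range n, F i (m i ω)) ∂μ) atTop
      (𝓝 (∫⁻ ω, nexp (∑' i, F i (m i ω)) ∂μ)) := by
    refine tendsto_lintegral_of_dominated_convergence (fun _ => 1) (fun n => ?_) (fun n => ?_)
      (by simp) (ae_of_all _ fun ω => ?_)
    · exact measurable_nexp.comp
        (Finset.measurable_sum _ fun i _ => (hF i).comp (hm i))
    · exact ae_of_all _ fun ω => nexp_le_one _
    · exact (continuous_nexp.tendsto _).comp (ENNReal.tendsto_nat_tsum _)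
  have h2 : Tendsto (fun n : ℕ => nexp (∑ i ∈ Finset.range n, f i)) atTop (𝓝 (nexp (∑' i, f i))) :=
    (continuous_nexp.tendsto _).comp (ENNReal.tendsto_nat_tsum _)
  simp_rw [hfin] at h1
  exact tendsto_nhds_unique h1 h2

/-! ### Exponential and Poisson laws -/

lemma expMeasure_one_eq : expMeasure 1 =
    volume.withDensity fun x => if 0 ≤ x then ENNReal.ofReal (Real.exp (-x)) else 0 := by
  change volume.withDensity (exponentialPDF 1) = _
  congr 1
  ext x
  rw [exponentialPDF_eq]
  split_ifs <;> simp

lemma expMeasure_one_Ioi {a : ℝ} (ha : 0 ≤ a) :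
    expMeasure 1 (Ioi a) = ENNReal.ofReal (Real.exp (-a)) := by
  have := isProbabilityMeasure_expMeasure one_pos
  have h := cdf_expMeasure_eq one_pos a
  rw [cdf_eq_real, if_pos ha, one_mul] at h
  have h2 := probReal_add_probReal_compl (μ := expMeasure 1) (measurableSet_Iic (a := a))
  rw [compl_Iic, h] at h2
  rw [← ofReal_measureReal]
  congr 1
  linarith

/-- Allowing `a = ∞`, where both sides vanish, is what later makes the coverage formula valid for
infinite interference. -/
lemma expMeasure_one_lt (a : ℝ≥0∞) : expMeasure 1 {x | a < ENNReal.ofReal x} = nexp a := by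
  by_cases h : a = ∞
  · simp [h, nexp_top]
  · rw [← ENNReal.ofReal_toReal h, nexp_coe_real _ ENNReal.toReal_nonneg,
      ← expMeasure_one_Ioi ENNReal.toReal_nonneg]
    congr 1
    ext x
    simp only [mem_ofPred_eq, mem_Ioi]
    rw [ENNReal.ofReal_lt_ofReal_iff_of_nonneg ENNReal.toReal_nonneg]

lemma lintegral_nexp_expMeasure {a : ℝ} (ha : 0 ≤ a) :
    ∫⁻ x, nexp (ENNReal.ofReal a * ENNReal.ofReal x) ∂expMeasure 1
      = ENNReal.ofReal (1 + a)⁻¹ := by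
  have hm : Measurable fun x : ℝ => if 0 ≤ x then ENNReal.ofReal (Real.exp (-x)) else 0 :=
    Measurable.ite measurableSet_Ici (by fun_prop) measurable_const
  have hn : Measurable fun x : ℝ => nexp (ENNReal.ofReal a * ENNReal.ofReal x) :=
    measurable_nexp.comp (by fun_prop)
  rw [expMeasure_one_eq, lintegral_withDensity_eq_lintegral_mul _ hm hn]
  have : ∀ x : ℝ, ((fun x : ℝ => if 0 ≤ x then ENNReal.ofReal (Real.exp (-x)) else 0) *
      fun x => nexp (ENNReal.ofReal a * ENNReal.ofReal x)) x =
      (Ici (0 : ℝ)).indicator (fun x => ENNReal.ofReal (Real.exp (-(1 + a) * x))) x := by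
    intro x
    by_cases hx : 0 ≤ x
    · simp only [Pi.mul_apply, hx, if_true, mem_Ici, indicator_of_mem]
      rw [← ENNReal.ofReal_mul ha, nexp_coe_real _ (mul_nonneg ha hx),
        ← ENNReal.ofReal_mul (Real.exp_pos _).le, ← Real.exp_add]
      ring_nf
    · simp [hx]
  simp_rw [this]
  rw [lintegral_indicator measurableSet_Ici, setLIntegral_congr Ioi_ae_eq_Ici.symm,
    ← ofReal_integral_eq_lintegral_ofReal]
  · rw [integral_exp_mul_Ioi (by linarith)]
    rw [mul_zero, Real.exp_zero, neg_div_neg_eq, one_div]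
  · exact integrableOn_exp_mul_Ioi (by linarith) 0
  · exact ae_of_all _ fun x => (Real.exp_pos _).le

/-- This is the Poisson generating function at `p = nexp a`. The value `a = ∞`, that is `p = 0`,
gives the void probability. -/
lemma lintegral_nexp_poisson (r : ℝ≥0) (a : ℝ≥0∞) :
    ∫⁻ n : ℕ, nexp (a * n) ∂poissonMeasure r = nexp (r * (1 - nexp a)) := by
  obtain ⟨p, hp0, hp1, hp⟩ : ∃ p : ℝ, 0 ≤ p ∧ p ≤ 1 ∧ nexp a = ENNReal.ofReal p :=
    ⟨(nexp a).toReal, ENNReal.toReal_nonneg,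
      ENNReal.toReal_le_of_le_ofReal zero_le_one (by simpa using nexp_le_one a),
      (ENNReal.ofReal_toReal (nexp_ne_top a)).symm⟩
  have h1 : (1 : ℝ≥0∞) - nexp a = ENNReal.ofReal (1 - p) := by
    rw [hp, ENNReal.ofReal_sub _ hp0, ENNReal.ofReal_one]
  have hr : (0 : ℝ) ≤ r := r.2
  rw [h1, ← ENNReal.ofReal_coe_nnreal, ← ENNReal.ofReal_mul hr,
    nexp_coe_real _ (mul_nonneg hr (by linarith)), poissonMeasure, lintegral_sum_measure]
  simp_rw [lintegral_smul_measure, lintegral_dirac, smul_eq_mul, mul_comm a, nexp_nsmul, hp]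
  have hpos : ∀ n : ℕ, 0 ≤ Real.exp (-r) * (r : ℝ) ^ n / (n.factorial : ℝ) := fun n => by positivity
  simp_rw [← ENNReal.ofReal_pow hp0, ← ENNReal.ofReal_mul (hpos _)]
  have hs : HasSum (fun n : ℕ => Real.exp (-r) * (r : ℝ) ^ n / (n.factorial : ℝ) * p ^ n)
      (Real.exp (-(r * (1 - p)))) := by
    have h := (NormedSpace.expSeries_div_hasSum_exp ((r : ℝ) * p)).mul_left (Real.exp (-r))
    rw [← Real.exp_eq_exp_ℝ, ← Real.exp_add] at h
    rw [show -(r * (1 - p)) = -r + r * p by ring]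
    have he : (fun n : ℕ => Real.exp (-r) * (r : ℝ) ^ n / (n.factorial : ℝ) * p ^ n)
        = fun n => Real.exp (-r) * (((r : ℝ) * p) ^ n / n.factorial) := by
      ext n
      rw [mul_pow]
      ring
    rw [he]
    exact h
  rw [← ENNReal.ofReal_tsum_of_nonneg (fun n => by positivity) hs.summable, hs.tsum_eq]

/-! ### Laplace functional of a Poisson process -/

lemma tsum_iSup_of_monotone {f : ℕ → ℕ → ℝ≥0∞} (hf : ∀ i, Monotone fun n => f n i) :
    ∑' i, ⨆ n, f n i = ⨆ n, ∑' i, f n i := by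
  rw [← lintegral_count, lintegral_iSup (fun n => measurable_of_countable _)
    (fun m n h i => hf i h)]
  simp_rw [lintegral_count]

lemma encard_eq_tsum (B : Set ℕ) : (B.encard : ℝ≥0∞) = ∑' i, B.indicator 1 i := by
  rw [← ENNReal.tsum_set_one, ← tsum_subtype]
  rfl

-- Grouping the points by the value of `g` turns the sum into finitely many counts. The ball keeps
-- every level set bounded, as `IsHPPP` requires, including the level set of the value `0`.
open Classical in
lemma tsum_simpleFunc {Ω : Type*} {X : ℕ → Ω → Plane} {A : ℕ → Ω → Prop} (g : SimpleFunc Plane ℝ≥0∞) (R : ℝ) (ω : Ω) :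
    (∑' i, if A i ω then (Metric.ball (0 : Plane) R).indicator g (X i ω) else 0)
      = ∑ c ∈ g.range, c * ({i | A i ω ∧ X i ω ∈ g ⁻¹' {c} ∩ Metric.ball 0 R}.encard : ℝ≥0∞) := by
  have h1 : ∀ i, (if A i ω then (Metric.ball (0 : Plane) R).indicator g (X i ω) else 0)
      = ∑ c ∈ g.range, c * {i | A i ω ∧ X i ω ∈ g ⁻¹' {c} ∩ Metric.ball 0 R}.indicator 1 i := by
    intro i
    by_cases h : A i ω ∧ X i ω ∈ Metric.ball (0 : Plane) R
    · rw [if_pos h.1, indicator_of_mem h.2, Finset.sum_eq_single (g (X i ω))]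
      · rw [indicator_of_mem (show i ∈ {j | A j ω ∧ X j ω ∈ g ⁻¹' {g (X i ω)} ∩ Metric.ball 0 R}
          from ⟨h.1, rfl, h.2⟩)]
        simp
      · intro c _ hc
        rw [indicator_of_notMem, mul_zero]
        exact fun h' => hc h'.2.1.symm
      · intro h'; exact absurd (g.mem_range_self _) h'
    · rw [Finset.sum_eq_zero]
      · by_cases hA : A i ω
        · rw [if_pos hA, indicator_of_notMem fun h' => h ⟨hA, h'⟩]
        · rw [if_neg hA]
      · intro c _
        rw [indicator_of_notMem, mul_zero]
        exact fun h' => h ⟨h'.1, h'.2.2⟩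
  simp_rw [h1]
  rw [Summable.tsum_finsetSum fun _ _ => ENNReal.summable]
  refine Finset.sum_congr rfl fun c _ => ?_
  rw [ENNReal.tsum_mul_left, encard_eq_tsum]

section Functional

variable {Ω : Type*} [MeasurableSpace Ω] {μ : Measure Ω} {X : ℕ → Ω → Plane} {A : ℕ → Ω → Prop}

lemma measurable_encard (hX : ∀ i, Measurable (X i)) (hA : ∀ i, Measurable (A i))
    {B : Set Plane} (hB : MeasurableSet B) :
    Measurable fun ω => ({i | A i ω ∧ X i ω ∈ B}.encard : ℝ≥0∞) := by
  simp_rw [encard_eq_tsum]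
  refine Measurable.tsum fun i => ?_
  exact measurable_const.indicator
    ((measurableSet_setOfPred.2 (hA i)).inter (hX i hB)) (f := fun _ : Ω => (1 : ℝ≥0∞))

/-- The predicate `A` selects a subfamily of the points, so the same statements serve the active BSs
and, with `A` always true, all BSs. -/
lemma lintegral_nexp_count {lam : ℝ}
    (h : IsHPPP (fun B ω => {i | A i ω ∧ X i ω ∈ B}.encard) lam μ) (hlam : 0 ≤ lam)
    {B : Set Plane} (hB : MeasurableSet B) (hb : Bornology.IsBounded B) (a : ℝ≥0∞) :
    ∫⁻ ω, nexp (a * ({i | A i ω ∧ X i ω ∈ B}.encard : ℝ≥0∞)) ∂μ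
      = nexp (ENNReal.ofReal lam * volume B * (1 - nexp a)) := by
  have hl := h.law B hB hb
  have hf : Measurable fun n : ℕ∞ => nexp (a * (n : ℝ≥0∞)) := Measurable.of_discrete
  rw [hl.lintegral_comp (f := fun n : ℕ∞ => nexp (a * (n : ℝ≥0∞))) hf.aemeasurable,
    lintegral_map hf Measurable.of_discrete]
  simp only [ENat.toENNReal_coe]
  rw [lintegral_nexp_poisson]
  congr 2
  change ENNReal.ofReal _ = _
  rw [ENNReal.ofReal_mul hlam, ofReal_measureReal hb.measure_lt_top.ne]

-- Level sets are disjoint, so their counts are independent Poisson variables and the expectation is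
-- a product of generating functions.
open Classical in
lemma lintegral_nexp_simpleFunc {lam : ℝ}
    (h : IsHPPP (fun B ω => {i | A i ω ∧ X i ω ∈ B}.encard) lam μ) (hlam : 0 ≤ lam)
    (hX : ∀ i, Measurable (X i)) (hA : ∀ i, Measurable (A i))
    (g : SimpleFunc Plane ℝ≥0∞) (R : ℝ) :
    ∫⁻ ω, nexp (∑' i, if A i ω then (Metric.ball (0 : Plane) R).indicator g (X i ω) else 0) ∂μ
      = nexp (ENNReal.ofReal lam *
          ∫⁻ x, (1 - nexp ((Metric.ball (0 : Plane) R).indicator g x))) := by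
  set B : ℝ≥0∞ → Set Plane := fun c => g ⁻¹' {c} ∩ Metric.ball 0 R
  have hBm : ∀ c, MeasurableSet (B c) := fun c =>
    (g.measurableSet_preimage _).inter measurableSet_ball
  have hBb : ∀ c, Bornology.IsBounded (B c) := fun c => Metric.isBounded_ball.subset inter_subset_right
  simp_rw [tsum_simpleFunc, nexp_sum]
  -- Independence in `IsHPPP` is stated for families indexed by `Fin m`.
  let e := g.range.equivFin
  have hind := h.indep g.range.card (fun j => B (e.symm j).1) (fun j => hBm _) (fun j => hBb _)
    (by
      intro i j hij
      refine Disjoint.mono inter_subset_left inter_subset_left ?_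
      refine Disjoint.preimage _ ?_
      rw [disjoint_singleton]
      exact fun h' => hij (e.symm.injective (Subtype.ext h')))
  have hprod : ∫⁻ ω, ∏ c ∈ g.range, nexp (c * ({i | A i ω ∧ X i ω ∈ B c}.encard : ℝ≥0∞)) ∂μ
      = ∏ c ∈ g.range, nexp (ENNReal.ofReal lam * volume (B c) * (1 - nexp c)) := by
    simp_rw [← lintegral_nexp_count h hlam (hBm _) (hBb _)]
    rw [← Finset.prod_coe_sort, ← e.symm.prod_comp,
      ← lintegral_prod_eq_prod_lintegral_of_indepFun Finset.univ
        (fun j ω => nexp ((e.symm j).1 * ({i | A i ω ∧ X i ω ∈ B (e.symm j).1}.encard : ℝ≥0∞)))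
        (hind.comp (fun j n => nexp ((e.symm j).1 * (n : ℝ≥0∞))) fun j => Measurable.of_discrete)]
    · refine lintegral_congr fun ω => ?_
      rw [← Finset.prod_coe_sort, ← e.symm.prod_comp]
    · intro j
      exact measurable_nexp.comp ((measurable_encard hX hA (hBm _)).const_mul _)
  rw [hprod, ← nexp_sum]
  congr 1
  simp_rw [mul_assoc]
  rw [← Finset.mul_sum]
  congr 1
  -- The integrand is constant on each `B c` and vanishes off the ball because `nexp 0 = 1`.
  have : ∀ x, 1 - nexp ((Metric.ball (0 : Plane) R).indicator g x)
      = ∑ c ∈ g.range, (B c).indicator (fun _ => 1 - nexp c) x := by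
    intro x
    by_cases hx : x ∈ Metric.ball (0 : Plane) R
    · rw [indicator_of_mem hx, Finset.sum_eq_single (g x)]
      · rw [indicator_of_mem (show x ∈ B (g x) from ⟨rfl, hx⟩)]
      · intro c _ hc
        exact indicator_of_notMem (fun h' => hc h'.1.symm) _
      · intro h'; exact absurd (g.mem_range_self _) h'
    · rw [indicator_of_notMem hx, Finset.sum_eq_zero]
      · simp [nexp_zero]
      · intro c _
        exact indicator_of_notMem (fun h' => hx h'.2) _
  simp_rw [this]
  rw [lintegral_finsetSum _ fun c _ => measurable_const.indicator (hBm c)]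
  refine Finset.sum_congr rfl fun c _ => ?_
  rw [lintegral_indicator_const (hBm c), mul_comm]

open Classical in
/-- The Laplace functional of a homogeneous Poisson point process. -/
lemma lintegral_nexp_hppp {lam : ℝ}
    (h : IsHPPP (fun B ω => {i | A i ω ∧ X i ω ∈ B}.encard) lam μ) (hlam : 0 ≤ lam)
    [IsProbabilityMeasure μ]
    (hX : ∀ i, Measurable (X i)) (hA : ∀ i, Measurable (A i))
    {f : Plane → ℝ≥0∞} (hf : Measurable f) :
    ∫⁻ ω, nexp (∑' i, if A i ω then f (X i ω) else 0) ∂μ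
      = nexp (ENNReal.ofReal lam * ∫⁻ x, (1 - nexp (f x))) := by
  -- Simple approximations cut off to growing balls: they increase to `f`, and each has bounded
  -- support.
  set F : ℕ → Plane → ℝ≥0∞ := fun n => (Metric.ball (0 : Plane) n).indicator (SimpleFunc.eapprox f n)
  have hFm : ∀ n, Measurable (F n) := fun n =>
    (SimpleFunc.measurable _).indicator measurableSet_ball
  have hFmono : ∀ x, Monotone fun n => F n x := by
    intro x m n hmn
    refine (indicator_le_indicator_of_subset (Metric.ball_subset_ball (Nat.cast_le.2 hmn))
      (fun _ => zero_le) x).trans (indicator_le_indicator ?_)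
    exact SimpleFunc.monotone_eapprox f hmn x
  have hFsup : ∀ x, ⨆ n, F n x = f x := by
    intro x
    apply le_antisymm
    · refine iSup_le fun n => ?_
      refine (indicator_le_self' (fun _ _ => zero_le) x).trans ?_
      rw [← SimpleFunc.iSup_eapprox_apply hf x]
      exact le_iSup (fun n => (SimpleFunc.eapprox f n) x) n
    · rw [← SimpleFunc.iSup_eapprox_apply hf x]
      refine iSup_le fun n => ?_
      obtain ⟨N, hN⟩ := exists_nat_gt ‖x‖
      refine le_trans ?_ (le_iSup (fun n => F n x) (max n N))
      have : x ∈ Metric.ball (0 : Plane) ((max n N : ℕ) : ℝ) := by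
        rw [mem_ball_zero_iff]
        exact hN.trans_le (by exact_mod_cast le_max_right n N)
      simp only [F, indicator_of_mem this]
      exact SimpleFunc.monotone_eapprox f (le_max_left _ _) x
  have hTmono : ∀ ω, Monotone fun n => ∑' i, if A i ω then F n (X i ω) else 0 := by
    intro ω m n hmn
    refine ENNReal.tsum_le_tsum fun i => ?_
    split_ifs
    exacts [hFmono _ hmn, le_rfl]
  have hTsup : ∀ ω, ⨆ n, (∑' i, if A i ω then F n (X i ω) else 0)
      = ∑' i, if A i ω then f (X i ω) else 0 := by
    intro ω
    rw [← tsum_iSup_of_monotone]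
    · refine tsum_congr fun i => ?_
      split_ifs
      · exact hFsup _
      · simp
    · intro i m n hmn
      dsimp only
      split_ifs
      exacts [hFmono _ hmn, le_rfl]
  have h1 : Tendsto (fun n => ∫⁻ ω, nexp (∑' i, if A i ω then F n (X i ω) else 0) ∂μ) atTop
      (𝓝 (∫⁻ ω, nexp (∑' i, if A i ω then f (X i ω) else 0) ∂μ)) := by
    refine tendsto_lintegral_of_dominated_convergence (fun _ => 1) (fun n => ?_) (fun n => ?_)
      (by simp) (ae_of_all _ fun ω => ?_)
    · refine measurable_nexp.comp (Measurable.tsum fun i => ?_)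
      exact Measurable.ite (measurableSet_setOfPred.2 (hA i)) ((hFm n).comp (hX i)) measurable_const
    · exact ae_of_all _ fun ω => nexp_le_one _
    · refine (continuous_nexp.tendsto _).comp ?_
      rw [← hTsup]
      exact tendsto_atTop_iSup (hTmono ω)
  have h2 : Tendsto (fun n => nexp (ENNReal.ofReal lam * ∫⁻ x, (1 - nexp (F n x)))) atTop
      (𝓝 (nexp (ENNReal.ofReal lam * ∫⁻ x, (1 - nexp (f x))))) := by
    refine (continuous_nexp.tendsto _).comp (ENNReal.Tendsto.const_mul ?_
      (Or.inr ENNReal.ofReal_ne_top))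
    refine lintegral_tendsto_of_tendsto_of_monotone
      (fun n => (measurable_const.sub (measurable_nexp.comp (hFm n))).aemeasurable)
      (ae_of_all _ fun x m n hmn => tsub_le_tsub_left (antitone_nexp (hFmono x hmn)) _)
      (ae_of_all _ fun x => ?_)
    refine ENNReal.Tendsto.sub tendsto_const_nhds ?_ (Or.inl ENNReal.one_ne_top)
    refine (continuous_nexp.tendsto _).comp ?_
    rw [← hFsup]
    exact tendsto_atTop_iSup (hFmono x)
  simp_rw [F, lintegral_nexp_simpleFunc h hlam hX hA] at h1
  exact tendsto_nhds_unique h1 h2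

end Functional

/-! ### Independent marking -/

section Marked

variable {Ω : Type*} [MeasurableSpace Ω] {μ : Measure Ω} [IsProbabilityMeasure μ]

/-- Fubini for the product law, written with an independent copy on `Ω` itself so that it can be
combined with facts about the variables on `Ω`. -/
lemma lintegral_indepFun {α β : Type*} [MeasurableSpace α] [MeasurableSpace β] {D : Ω → α}
    {m : Ω → β} (hD : Measurable D) (hm : Measurable m) (hind : IndepFun D m μ)
    {f : α → β → ℝ≥0∞} (hf : Measurable (Function.uncurry f)) :
    ∫⁻ ω, f (D ω) (m ω) ∂μ = ∫⁻ ω, ∫⁻ ω', f (D ω) (m ω') ∂μ ∂μ := by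
  have h := (indepFun_iff_map_prod_eq_prod_map_map hD.aemeasurable hm.aemeasurable).1 hind
  have := Measure.isProbabilityMeasure_map (μ := μ) hm.aemeasurable
  have h1 : ∫⁻ ω, f (D ω) (m ω) ∂μ
      = ∫⁻ p, Function.uncurry f p ∂(μ.map fun ω => (D ω, m ω)) := by
    rw [lintegral_map hf (hD.prodMk hm)]
    rfl
  rw [h1, h, lintegral_prod _ hf.aemeasurable, lintegral_map hf.lintegral_prod_right' hD]
  refine lintegral_congr fun ω => ?_
  exact lintegral_map (hf.comp measurable_prodMk_left) hm

open Classical in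
/-- The Laplace functional of an independently marked homogeneous Poisson point process. -/
lemma lintegral_nexp_marked {β : Type*} [MeasurableSpace β] {X : ℕ → Ω → Plane}
    {A : ℕ → Ω → Prop} {m : ℕ → Ω → β} {κ : Measure β} [SFinite κ] {lam : ℝ}
    (h : IsHPPP (fun B ω => {i | A i ω ∧ X i ω ∈ B}.encard) lam μ) (hlam : 0 ≤ lam)
    (hX : ∀ i, Measurable (X i)) (hA : ∀ i, Measurable (A i)) (hm : ∀ i, Measurable (m i))
    (hlaw : ∀ i, HasLaw (m i) κ μ) (hindm : iIndepFun m μ)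
    (hind : IndepFun (fun ω i => (X i ω, A i ω)) (fun ω i => m i ω) μ)
    {F : Plane → β → ℝ≥0∞} (hF : Measurable (Function.uncurry F)) :
    ∫⁻ ω, nexp (∑' i, if A i ω then F (X i ω) (m i ω) else 0) ∂μ
      = nexp (ENNReal.ofReal lam * ∫⁻ x, (1 - ∫⁻ b, nexp (F x b) ∂κ)) := by
  have hκ : IsProbabilityMeasure κ := (hlaw 0).isProbabilityMeasure_iff.1 inferInstance
  have hF' : ∀ x, Measurable (F x) := fun x => hF.comp measurable_prodMk_left
  have hle : ∀ x, ∫⁻ b, nexp (F x b) ∂κ ≤ 1 := fun x =>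
    (lintegral_mono fun b => nexp_le_one _).trans (by simp)
  have hfm : Measurable fun x => ∫⁻ b, nexp (F x b) ∂κ :=
    (measurable_nexp.comp hF).lintegral_prod_right'
  -- Chosen so that averaging the mark of a point at `x` produces exactly `nexp (f x)`; the marked
  -- functional becomes the unmarked one of `f`. A vanishing average corresponds to `f x = ∞`.
  set f : Plane → ℝ≥0∞ := fun x => nlog (∫⁻ b, nexp (F x b) ∂κ)
  have hfexp : ∀ x, nexp (f x) = ∫⁻ b, nexp (F x b) ∂κ := fun x => nexp_nlog (hle x)
  simp_rw [← hfexp]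
  have hfm' : Measurable f := measurable_nlog.comp hfm
  rw [← lintegral_nexp_hppp h hlam hX hA hfm']
  have hG : Measurable (Function.uncurry fun (d : ℕ → Plane × Prop) (b : ℕ → β) =>
      nexp (∑' i, if (d i).2 then F (d i).1 (b i) else 0)) := by
    refine measurable_nexp.comp (Measurable.tsum fun i => ?_)
    refine Measurable.ite (measurableSet_setOfPred.2 ?_) ?_ measurable_const
    · exact measurable_snd.comp ((measurable_pi_apply i).comp measurable_fst)
    · exact hF.comp ((measurable_fst.comp ((measurable_pi_apply i).comp measurable_fst)).prodMk
        ((measurable_pi_apply i).comp measurable_snd))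
  -- Freeze the deployment; the remaining integral is over a series of independent functions of the
  -- marks.
  rw [lintegral_indepFun (D := fun ω i => (X i ω, A i ω)) (m := fun ω i => m i ω)
    (f := fun (d : ℕ → Plane × Prop) (b : ℕ → β) =>
      nexp (∑' i, if (d i).2 then F (d i).1 (b i) else 0))
    (measurable_pi_lambda _ fun i => (hX i).prodMk (hA i)) (measurable_pi_lambda _ hm) hind hG]
  refine lintegral_congr fun ω => ?_
  refine lintegral_nexp_tsum hm hindm (F := fun i b => if A i ω then F (X i ω) b else 0) ?_ ?_
  · intro i
    split_ifs
    exacts [hF' _, measurable_const]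
  · intro i
    split_ifs
    · rw [hfexp, (hlaw i).lintegral_comp (f := fun b => nexp (F (X i ω) b))
        (measurable_nexp.comp (hF' _)).aemeasurable]
    · simp [nexp_zero]

end Marked

/-! ### Polar coordinates in the plane -/

/-- Integration of radial functions in the plane. -/
lemma lintegral_norm_plane {f : ℝ → ℝ≥0∞} (hf : Measurable f) :
    ∫⁻ x : Plane, f ‖x‖ = ENNReal.ofReal (2 * Real.pi) *
      ∫⁻ u in Ioi (0 : ℝ), ENNReal.ofReal u * f u := by
  have hdim : Module.finrank ℝ Plane = 2 := by simp
  have h0 : ∫⁻ x : Plane, f ‖x‖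
      = ∫⁻ x : ({(0 : Plane)}ᶜ : Set Plane), f ‖x.1‖ ∂((volume : Measure Plane).comap (↑)) := by
    rw [lintegral_subtype_comap (measurableSet_singleton _).compl fun x : Plane => f (‖x‖),
        restrict_compl_singleton]
  have h1 : ∫⁻ x : ({(0 : Plane)}ᶜ : Set Plane), f ‖x.1‖ ∂((volume : Measure Plane).comap (↑))
      = ∫⁻ x : Metric.sphere (0 : Plane) 1 × Ioi (0 : ℝ), f x.2
        ∂(volume : Measure Plane).toSphere.prod (.volumeIoiPow (Module.finrank ℝ Plane - 1)) := by
    have := (volume : Measure Plane).measurePreserving_homeomorphUnitSphereProd.lintegral_comp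
        (f := f ∘ Subtype.val ∘ Prod.snd)
        (hf.comp (measurable_subtype_coe.comp measurable_snd))
    simpa using this
  have hm : Measurable fun x : Metric.sphere (0 : Plane) 1 × Ioi (0 : ℝ) => f x.2 :=
    hf.comp (measurable_subtype_coe.comp measurable_snd)
  have hm' : Measurable fun x : Ioi (0 : ℝ) => f x := hf.comp measurable_subtype_coe
  rw [h0, h1, lintegral_prod _ hm.aemeasurable]
  dsimp only
  rw [lintegral_const, Measure.toSphere_apply_univ, hdim, mul_comm]
  congr 1
  · rw [EuclideanSpace.volume_ball]
    have : (1 : ℝ) + 1 = 2 := by norm_num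
    simp [this, Real.sq_sqrt Real.pi_pos.le, ENNReal.ofReal_mul]
  · rw [Measure.volumeIoiPow, lintegral_withDensity_eq_lintegral_mul _ (by fun_prop)
      hm',
      ← lintegral_subtype_comap measurableSet_Ioi]
    simp

/-! ### Measurability of the path-loss model and the average over one mark -/

namespace PathLoss

variable {k : ℕ} {M : PathLoss k}

lemma le_dist3 (M : PathLoss k) (r : ℝ) : M.L ≤ M.dist3 r := by
  apply Real.le_sqrt_of_sq_le
  nlinarith [sq_nonneg r]

lemma measurable_dist3 (M : PathLoss k) : Measurable M.dist3 := by
  unfold dist3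
  fun_prop

lemma monotone_piece (M : PathLoss k) : Monotone M.piece := by
  intro a b hab
  refine Fin.mk_le_mk.2 (Finset.card_le_card fun n hn => ?_)
  simp only [Finset.mem_filter, Finset.mem_univ, true_and] at hn ⊢
  exact hn.trans_le hab

lemma measurable_piece (M : PathLoss k) : Measurable M.piece := by
  refine measurable_to_countable' fun n => Set.OrdConnected.measurableSet ?_
  exact ordConnected_singleton.preimage_mono M.monotone_piece

lemma measurable_zetaL (M : PathLoss k) : Measurable M.zetaL := by
  have h : Measurable fun p : Fin (k + 1) × ℝ => M.zetaPieceL p.1 p.2 :=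
    measurable_from_prod_countable_right fun n => by
      unfold zetaPieceL
      fun_prop
  exact h.comp (M.measurable_piece.prodMk measurable_id)

lemma measurable_zetaNL (M : PathLoss k) : Measurable M.zetaNL := by
  have h : Measurable fun p : Fin (k + 1) × ℝ => M.zetaPieceNL p.1 p.2 :=
    measurable_from_prod_countable_right fun n => by
      unfold zetaPieceNL
      fun_prop
  exact h.comp (M.measurable_piece.prodMk measurable_id)

lemma Valid.PrL_mem (hM : M.Valid) {w : ℝ} (hw : M.L ≤ w) : M.PrL w ∈ Icc (0 : ℝ) 1 :=
  hM.prL_mem _ w hw rfl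

/-- No measurability of `prL` is assumed. Being antitone and bounded on its piece, each `prL n`
extends to an antitone function on `ℝ`, which is measurable. The composition with `dist3` keeps the
argument at or above `L`, the only range where the assumptions apply. -/
lemma Valid.measurable_PrL (hM : M.Valid) : Measurable fun r => M.PrL (M.dist3 r) := by
  have hext : ∀ n, ∃ g : ℝ → ℝ, Antitone g ∧ EqOn (M.prL n) g {w | M.L ≤ w ∧ M.piece w = n} := by
    intro n
    refine (hM.prL_anti n).exists_antitone_extension ⟨0, ?_⟩ ⟨1, ?_⟩
    · rintro _ ⟨w, hw, rfl⟩
      exact (hM.prL_mem n w hw.1 hw.2).1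
    · rintro _ ⟨w, hw, rfl⟩
      exact (hM.prL_mem n w hw.1 hw.2).2
  choose g hg hgeq using hext
  have h : Measurable fun p : Fin (k + 1) × ℝ => g p.1 p.2 :=
    measurable_from_prod_countable_right fun n => (hg n).measurable
  have h2 := h.comp ((M.measurable_piece.prodMk measurable_id).comp M.measurable_dist3)
  convert h2 using 1
  ext r
  exact hgeq _ ⟨M.le_dist3 r, rfl⟩

lemma Valid.zetaL_pos (hM : M.Valid) {w : ℝ} (hw : M.L ≤ w) : 0 < M.zetaL w :=
  mul_pos (hM.AL_pos _) (Real.rpow_pos_of_pos (hM.L_pos.trans_le hw) _)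

lemma Valid.zetaNL_pos (hM : M.Valid) {w : ℝ} (hw : M.L ≤ w) : 0 < M.zetaNL w :=
  mul_pos (hM.ANL_pos _) (Real.rpow_pos_of_pos (hM.L_pos.trans_le hw) _)

open Classical in
/-- The path loss of a link to a BS at 2D distance `r` with LoS variable `u`. -/
noncomputable def gain (M : PathLoss k) (r u : ℝ) : ℝ :=
  if u < M.PrL (M.dist3 r) then M.zetaL (M.dist3 r) else M.zetaNL (M.dist3 r)

lemma Valid.gain_pos (hM : M.Valid) (r u : ℝ) : 0 < M.gain r u := by
  unfold gain
  split_ifs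
  exacts [hM.zetaL_pos (M.le_dist3 r), hM.zetaNL_pos (M.le_dist3 r)]

lemma Valid.measurable_gain (hM : M.Valid) : Measurable fun p : ℝ × ℝ => M.gain p.1 p.2 := by
  refine Measurable.ite (measurableSet_lt measurable_snd (hM.measurable_PrL.comp measurable_fst))
    ?_ ?_
  · exact (M.measurable_zetaL.comp M.measurable_dist3).comp measurable_fst
  · exact (M.measurable_zetaNL.comp M.measurable_dist3).comp measurable_fst

lemma lintegral_uniform_ite {p : ℝ} (hp : p ∈ Icc (0 : ℝ) 1) (a b : ℝ≥0∞) :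
    ∫⁻ u in Icc (0 : ℝ) 1, (if u < p then a else b) = ENNReal.ofReal p * a + ENNReal.ofReal (1 - p) * b := by
  have h : ∀ u : ℝ, (if u < p then a else b) =
      (Iio p).indicator (fun _ => a) u + (Ici p).indicator (fun _ => b) u := by
    intro u
    by_cases hu : u < p
    · simp [hu]
    · simp [hu, not_lt.1 hu]
  simp_rw [h]
  rw [lintegral_add_left (measurable_const.indicator measurableSet_Iio),
    lintegral_indicator_const measurableSet_Iio, lintegral_indicator_const measurableSet_Ici,
    Measure.restrict_apply measurableSet_Iio, Measure.restrict_apply measurableSet_Ici]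
  have h1 : Iio p ∩ Icc 0 1 = Ico 0 p := by
    ext u
    simp only [mem_inter_iff, mem_Iio, mem_Icc, mem_Ico]
    exact ⟨fun h => ⟨h.2.1, h.1⟩, fun h => ⟨h.2, h.1, h.2.le.trans hp.2⟩⟩
  have h2 : Ici p ∩ Icc 0 1 = Icc p 1 := by
    ext u
    simp only [mem_inter_iff, mem_Ici, mem_Icc]
    exact ⟨fun h => ⟨h.1, h.2.2⟩, fun h => ⟨h.1, hp.1.trans h.1, h.2⟩⟩
  rw [h1, h2, Real.volume_Ico, Real.volume_Icc, sub_zero, mul_comm a, mul_comm b]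

/-- The contribution to the Laplace exponent of an interferer at 2D distance `r`. -/
lemma Valid.one_sub_lintegral_mark (hM : M.Valid) {c : ℝ} (hc : 0 < c) (r : ℝ) :
    1 - ∫⁻ b : ℝ × ℝ, nexp (ENNReal.ofReal (c * M.gain r b.1) * ENNReal.ofReal b.2)
        ∂((volume.restrict (Icc (0 : ℝ) 1)).prod (expMeasure 1))
      = ENNReal.ofReal (M.PrL (M.dist3 r) / (1 + (c * M.zetaL (M.dist3 r))⁻¹))
        + ENNReal.ofReal ((1 - M.PrL (M.dist3 r)) / (1 + (c * M.zetaNL (M.dist3 r))⁻¹)) := by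
  have := isProbabilityMeasure_expMeasure one_pos
  have hp := hM.PrL_mem (M.le_dist3 r)
  have ha := mul_pos hc (hM.zetaL_pos (M.le_dist3 r))
  have hb := mul_pos hc (hM.zetaNL_pos (M.le_dist3 r))
  have hm : Measurable fun b : ℝ × ℝ =>
      nexp (ENNReal.ofReal (c * M.gain r b.1) * ENNReal.ofReal b.2) := by
    refine measurable_nexp.comp (Measurable.mul (Measurable.ennreal_ofReal ?_)
      (measurable_snd.ennreal_ofReal))
    exact (hM.measurable_gain.comp (measurable_const.prodMk measurable_fst)).const_mul c
  rw [lintegral_prod _ hm.aemeasurable]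
  have h : ∀ u : ℝ, ∫⁻ y, nexp (ENNReal.ofReal (c * M.gain r (u, y).1) * ENNReal.ofReal (u, y).2)
        ∂expMeasure 1 = if u < M.PrL (M.dist3 r) then ENNReal.ofReal (1 + c * M.zetaL (M.dist3 r))⁻¹
          else ENNReal.ofReal (1 + c * M.zetaNL (M.dist3 r))⁻¹ := by
    intro u
    rw [lintegral_nexp_expMeasure (mul_pos hc (hM.gain_pos r u)).le, gain]
    split_ifs <;> rfl
  simp_rw [h]
  rw [lintegral_uniform_ite hp]
  generalize M.PrL (M.dist3 r) = p at *
  generalize c * M.zetaL (M.dist3 r) = a at *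
  generalize c * M.zetaNL (M.dist3 r) = b at *
  have h0 : 0 ≤ 1 - p := by linarith [hp.2]
  -- The real identity behind this is `1 - 1 / (1 + a) = 1 / (1 + a⁻¹)`, averaged with weights `p`
  -- and `1 - p`.
  rw [← ENNReal.ofReal_mul hp.1, ← ENNReal.ofReal_mul h0,
    ← ENNReal.ofReal_add (mul_nonneg hp.1 (by positivity)) (mul_nonneg h0 (by positivity)),
    ← ENNReal.ofReal_add (div_nonneg hp.1 (by positivity)) (div_nonneg h0 (by positivity)),
    ← ENNReal.ofReal_one, ← ENNReal.ofReal_sub _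
    (add_nonneg (mul_nonneg hp.1 (by positivity)) (mul_nonneg h0 (by positivity)))]
  congr 1
  field_simp
  ring

end PathLoss

/-! ### Total power received from the active BSs -/

namespace Network

variable {Ω : Type*} [MeasurableSpace Ω] {μ : Measure Ω} [IsProbabilityMeasure μ] {k : ℕ}
  {M : PathLoss k} {S : Network Ω}

open Classical in
/-- The sum of the received powers of all active BSs. -/
noncomputable def totalPower {Ω : Type*} (S : Network Ω) (M : PathLoss k) (P : ℝ) (ω : Ω) : ℝ≥0∞ :=
  ∑' i : ℕ, if S.active i ω then ENNReal.ofReal (P * S.pathLoss M i ω * S.h i ω) else 0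

lemma pathLoss_eq {Ω : Type*} (S : Network Ω) (M : PathLoss k) (i : ℕ) (ω : Ω) :
    S.pathLoss M i ω = M.gain ‖S.X i ω‖ (S.U i ω) := rfl

open Classical in
/-- The Laplace transform of the total power received from active BSs. -/
lemma Valid.lintegral_nexp_totalPower {q rho lam P s : ℝ} (hS : S.Valid μ q rho lam)
    (hM : M.Valid) (hd : 0 ≤ activeDensity q rho lam) (hP : 0 < P) (hs : 0 < s) :
    ∫⁻ ω, nexp (ENNReal.ofReal s * S.totalPower M P ω) ∂μ
      = nexp (ENNReal.ofReal (activeDensity q rho lam) *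
          (ENNReal.ofReal (2 * Real.pi) * (M.integralL P s + M.integralNL P s))) := by
  have := isProbabilityMeasure_expMeasure one_pos
  have hF : Measurable (Function.uncurry fun (x : Plane) (b : ℝ × ℝ) =>
      ENNReal.ofReal (s * P * M.gain ‖x‖ b.1) * ENNReal.ofReal b.2) := by
    refine Measurable.mul (Measurable.ennreal_ofReal ?_)
      ((measurable_snd.comp measurable_snd).ennreal_ofReal)
    exact (hM.measurable_gain.comp
      (measurable_fst.norm.prodMk (measurable_fst.comp measurable_snd))).const_mul _
  have key := lintegral_nexp_marked hS.hppp_active hd hS.measurable_X hS.measurable_active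
    (fun i => (hS.measurable_U i).prodMk (hS.measurable_h i)) hS.law_mark hS.indep_mark
    hS.indep_deployment hF
  have hL : ∀ ω, ENNReal.ofReal s * S.totalPower M P ω = ∑' i, if S.active i ω then
      ENNReal.ofReal (s * P * M.gain ‖S.X i ω‖ (S.U i ω)) * ENNReal.ofReal (S.h i ω) else 0 := by
    intro ω
    rw [totalPower, ← ENNReal.tsum_mul_left]
    refine tsum_congr fun i => ?_
    split_ifs
    · rw [pathLoss_eq, ← ENNReal.ofReal_mul hs.le, ← ENNReal.ofReal_mul]
      · ring_nf
      · exact (mul_pos (mul_pos hs hP) (hM.gain_pos _ _)).le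
    · simp
  simp_rw [hL]
  rw [key]
  congr 2
  simp_rw [hM.one_sub_lintegral_mark (mul_pos hs hP)]
  have hz1 : Measurable fun r => (s * P * M.zetaL (M.dist3 r))⁻¹ :=
    ((M.measurable_zetaL.comp M.measurable_dist3).const_mul (s * P)).inv
  have hz2 : Measurable fun r => (s * P * M.zetaNL (M.dist3 r))⁻¹ :=
    ((M.measurable_zetaNL.comp M.measurable_dist3).const_mul (s * P)).inv
  have hm1 : Measurable fun r : ℝ => ENNReal.ofReal (M.PrL (M.dist3 r) /
      (1 + (s * P * M.zetaL (M.dist3 r))⁻¹)) :=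
    (hM.measurable_PrL.div (hz1.const_add 1)).ennreal_ofReal
  have hm2 : Measurable fun r : ℝ => ENNReal.ofReal ((1 - M.PrL (M.dist3 r)) /
      (1 + (s * P * M.zetaNL (M.dist3 r))⁻¹)) :=
    ((hM.measurable_PrL.const_sub 1).div (hz2.const_add 1)).ennreal_ofReal
  refine (lintegral_norm_plane (hm1.add hm2)).trans ?_
  congr 1
  simp_rw [Pi.add_apply, mul_add]
  refine (lintegral_add_left (measurable_id.ennreal_ofReal.mul hm1) _).trans ?_
  congr 1
  · refine setLIntegral_congr_fun measurableSet_Ioi fun u hu => ?_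
    simp only [Pi.mul_apply, id]
    rw [← ENNReal.ofReal_mul (le_of_lt hu)]
    ring_nf
  · refine setLIntegral_congr_fun measurableSet_Ioi fun u hu => ?_
    rw [← ENNReal.ofReal_mul (le_of_lt hu)]
    ring_nf

end Network

/-! ### Independence and comparison with an exponential variable -/

section Independence

variable {Ω : Type*} [MeasurableSpace Ω] {μ : Measure Ω}

lemma indepFun_restrict_of_disjoint {ι β : Type*} [MeasurableSpace β] {f : ι → Ω → β}
    (hf : ∀ i, Measurable (f i)) (hind : iIndepFun f μ) {s t : Set ι} (hst : Disjoint s t) :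
    IndepFun (fun ω (i : s) => f i ω) (fun ω (i : t) => f i ω) μ := by
  rw [IndepFun_iff_Indep]
  have h := indep_iSup_of_disjoint (fun i => (hf i).comap_le)
    ((iIndepFun_iff_iIndep _ _ _).1 hind) hst
  have hle : ∀ u : Set ι, MeasurableSpace.comap (fun ω (i : u) => f i ω) MeasurableSpace.pi
      ≤ ⨆ i ∈ u, MeasurableSpace.comap (f i) inferInstance := by
    intro u
    rw [MeasurableSpace.pi, MeasurableSpace.comap_iSup]
    refine iSup_le fun i => ?_
    rw [MeasurableSpace.comap_comp]
    exact le_iSup₂_of_le i.1 i.2 le_rfl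
  exact indep_of_indep_of_le_left (indep_of_indep_of_le_right h (hle t)) (hle s)

lemma iIndepFun_bool {β : Type*} [MeasurableSpace β] [IsProbabilityMeasure μ] {f : Bool → Ω → β}
    (h : IndepFun (f true) (f false) μ) : iIndepFun f μ := by
  rw [iIndepFun_iff_measure_inter_preimage_eq_mul]
  intro S sets H
  have hS : S = ∅ ∨ S = {true} ∨ S = {false} ∨ S = {true, false} := by
    clear H
    revert S
    decide
  rcases hS with rfl | rfl | rfl | rfl
  · simp
  · simp
  · simp
  · rw [Finset.prod_pair (by simp), Finset.set_biInter_insert, Finset.set_biInter_singleton]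
    exact h.measure_inter_preimage_eq_mul _ _ (H true (by simp)) (H false (by simp))

/-- Independence between and within the pairs makes the whole family over `ℕ × Bool` independent;
splitting it by the Boolean separates the two sequences. -/
lemma indepFun_sequences {β : Type*} [MeasurableSpace β] [IsProbabilityMeasure μ]
    {f g : ℕ → Ω → β} (hf : ∀ i, Measurable (f i)) (hg : ∀ i, Measurable (g i))
    (hind : iIndepFun (fun i ω => (f i ω, g i ω)) μ) (hfg : ∀ i, IndepFun (f i) (g i) μ) :
    IndepFun (fun ω i => f i ω) (fun ω i => g i ω) μ := by
  let Z : ℕ → Bool → Ω → β := fun i b => cond b (f i) (g i)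
  have hZ : ∀ i b, Measurable (Z i b) := by
    rintro i (_ | _)
    exacts [hg i, hf i]
  have h1 : iIndepFun (fun i ω b => Z i b ω) μ := by
    have := hind.comp (fun _ (p : β × β) (b : Bool) => cond b p.1 p.2) fun _ => by
      refine measurable_pi_lambda _ ?_
      rintro (_ | _)
      exacts [measurable_snd, measurable_fst]
    convert this using 1
    ext i ω b
    cases b <;> rfl
  have h2 := iIndepFun_uncurry' hZ h1 fun i => iIndepFun_bool (hfg i)
  have h3 := indepFun_restrict_of_disjoint (fun p : ℕ × Bool => hZ p.1 p.2) h2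
    (s := {p | p.2 = true}) (t := {p | p.2 = false}) (by
      rw [Set.disjoint_left]
      intro p hp hq
      simp_all)
  exact h3.comp (φ := fun r i => r ⟨(i, true), rfl⟩) (ψ := fun r i => r ⟨(i, false), rfl⟩)
    (measurable_pi_lambda _ fun i => measurable_pi_apply _)
    (measurable_pi_lambda _ fun i => measurable_pi_apply _)

/-- Under both hypotheses the joint law is a triple product, and the claim is its reassociation. -/
lemma IndepFun.assoc {α β γ : Type*} [MeasurableSpace α] [MeasurableSpace β]
    [MeasurableSpace γ] [IsProbabilityMeasure μ] {f : Ω → α} {g : Ω → β} {h : Ω → γ}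
    (hf : Measurable f) (hg : Measurable g) (hh : Measurable h)
    (h1 : IndepFun f (fun ω => (g ω, h ω)) μ) (h2 : IndepFun g h μ) :
    IndepFun (fun ω => (f ω, g ω)) h μ := by
  have hfg : IndepFun f g μ := h1.comp measurable_id measurable_fst
  have := Measure.isProbabilityMeasure_map (μ := μ) hf.aemeasurable
  have := Measure.isProbabilityMeasure_map (μ := μ) hg.aemeasurable
  have := Measure.isProbabilityMeasure_map (μ := μ) hh.aemeasurable
  rw [indepFun_iff_map_prod_eq_prod_map_map (hf.prodMk hg).aemeasurable hh.aemeasurable,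
    (indepFun_iff_map_prod_eq_prod_map_map hf.aemeasurable hg.aemeasurable).1 hfg]
  rw [indepFun_iff_map_prod_eq_prod_map_map hf.aemeasurable (hg.prodMk hh).aemeasurable,
    (indepFun_iff_map_prod_eq_prod_map_map hg.aemeasurable hh.aemeasurable).1 h2,
    ← Measure.prodAssoc_prod] at h1
  apply MeasurableEquiv.prodAssoc.map_measurableEquiv_injective
  rw [← h1, Measure.map_map MeasurableEquiv.prodAssoc.measurable ((hf.prodMk hg).prodMk hh)]
  rfl

open Classical in
/-- An exponential random variable exceeds a function of the other variables of an independent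
family with the corresponding exponential probability. -/
lemma measure_lt_exponential {h : ℕ → Ω → ℝ} (hh : ∀ i, Measurable (h i)) (hind : iIndepFun h μ)
    {b : ℕ} (hlaw : HasLaw (h b) (expMeasure 1) μ) {G : (ℕ → ℝ) → ℝ≥0∞} (hG : Measurable G)
    (hGb : ∀ v x, G (Function.update v b x) = G v) :
    μ {ω | G (fun i => h i ω) < ENNReal.ofReal (h b ω)} = ∫⁻ ω, nexp (G fun i => h i ω) ∂μ := by
  have := hind.isProbabilityMeasure
  -- Refills coordinate `b` with `0`. Since `G` ignores that coordinate, it factors through the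
  -- others and is thus independent of `h b`.
  let E : (({b}ᶜ : Set ℕ) → ℝ) → ℕ → ℝ := fun r i => if hi : i ∈ ({b}ᶜ : Set ℕ) then r ⟨i, hi⟩ else 0
  have hE : Measurable E := by
    refine measurable_pi_lambda _ fun i => ?_
    by_cases hi : i ∈ ({b}ᶜ : Set ℕ)
    · simp only [E, dif_pos hi]
      exact measurable_pi_apply _
    · simp only [E, dif_neg hi]
      exact measurable_const
  have hGE : ∀ ω, G (fun i => h i ω) = G (E fun i => h i ω) := by
    intro ω
    rw [← hGb (fun i => h i ω) 0]
    congr 1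
    ext i
    by_cases hi : i = b
    · subst hi
      simp [E]
    · simp [E, hi]
  have hI : IndepFun (fun ω => G fun i => h i ω) (h b) μ := by
    have hb : Measurable fun r : ({b} : Set ℕ) → ℝ => r ⟨b, rfl⟩ :=
      measurable_pi_apply (⟨b, rfl⟩ : ({b} : Set ℕ))
    have h3 := (indepFun_restrict_of_disjoint hh hind (s := {b}ᶜ) (t := {b})
      disjoint_compl_left).comp (hG.comp hE) hb
    have he : (fun ω => G fun i => h i ω) = (G ∘ E) ∘ fun ω (i : ({b}ᶜ : Set ℕ)) => h i ω :=
      funext hGE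
    rw [he]
    exact h3
  have hGm : Measurable fun ω => G fun i => h i ω := hG.comp (measurable_pi_lambda _ hh)
  have hset : MeasurableSet {ω | G (fun i => h i ω) < ENNReal.ofReal (h b ω)} :=
    measurableSet_lt hGm (hh b).ennreal_ofReal
  rw [← lintegral_indicator_one hset]
  have hlt : MeasurableSet {p : ℝ≥0∞ × ℝ | p.1 < ENNReal.ofReal p.2} :=
    measurableSet_lt measurable_fst measurable_snd.ennreal_ofReal
  have hm : Measurable (Function.uncurry fun (a : ℝ≥0∞) (x : ℝ) =>
      {p : ℝ≥0∞ × ℝ | p.1 < ENNReal.ofReal p.2}.indicator (1 : ℝ≥0∞ × ℝ → ℝ≥0∞) (a, x)) :=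
    measurable_one.indicator hlt
  refine (lintegral_indepFun hGm (hh b) hI hm).trans (lintegral_congr fun ω => ?_)
  generalize G (fun i => h i ω) = a
  have h1 : MeasurableSet {x : ℝ | a < ENNReal.ofReal x} :=
    measurableSet_lt measurable_const measurable_id.ennreal_ofReal
  have h2 : MeasurableSet {ω | a < ENNReal.ofReal (h b ω)} := hh b h1
  rw [← expMeasure_one_lt, ← hlaw.measure_eq h1, ← lintegral_indicator_one h2]
  rfl

end Independence

/-! ### The serving BS and conditioning on everything except fading -/

namespace Network

variable {k : ℕ} {M : PathLoss k}

section Measurability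

variable {Ω : Type*} [MeasurableSpace Ω] {S : Network Ω}

lemma measurable_pathLoss (hM : M.Valid) (hX : ∀ i, Measurable (S.X i))
    (hU : ∀ i, Measurable (S.U i)) (i : ℕ) : Measurable (S.pathLoss M i) :=
  hM.measurable_gain.comp ((hX i).norm.prodMk (hU i))

/-- Describes the level sets by countably many comparisons, for measurability. The second
alternative is the convention `sInf ∅ = 0`, which applies when no maximum is attained. -/
lemma serving_eq_iff {Ω : Type*} {S : Network Ω} (ω : Ω) (n : ℕ) : S.serving M ω = n ↔
    ((∀ j, S.pathLoss M j ω ≤ S.pathLoss M n ω) ∧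
      ∀ m < n, ¬ ∀ j, S.pathLoss M j ω ≤ S.pathLoss M m ω) ∨
    (n = 0 ∧ ∀ m, ¬ ∀ j, S.pathLoss M j ω ≤ S.pathLoss M m ω) := by
  classical
  rw [serving]
  constructor
  · rintro rfl
    by_cases hne : {i : ℕ | ∀ j, S.pathLoss M j ω ≤ S.pathLoss M i ω}.Nonempty
    · exact Or.inl ⟨Nat.sInf_mem hne, fun m hm => Nat.notMem_of_lt_sInf hm⟩
    · rw [not_nonempty_iff_eq_empty] at hne
      refine Or.inr ⟨by rw [hne, Nat.sInf_empty], fun m hm => ?_⟩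
      exact (Set.ext_iff.1 hne m).1 hm
  · rintro (⟨h1, h2⟩ | ⟨rfl, h⟩)
    · refine le_antisymm (Nat.sInf_le h1) (le_csInf ⟨n, h1⟩ fun m hm => ?_)
      by_contra hlt
      exact h2 m (not_le.1 hlt) hm
    · rw [Nat.sInf_eq_zero]
      right
      exact Set.eq_empty_of_forall_notMem h

lemma measurable_serving (hM : M.Valid) (hX : ∀ i, Measurable (S.X i))
    (hU : ∀ i, Measurable (S.U i)) : Measurable (S.serving M) := by
  have hmax : ∀ n, MeasurableSet {ω | ∀ j, S.pathLoss M j ω ≤ S.pathLoss M n ω} := fun n => by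
    rw [ofPred_forall]
    exact MeasurableSet.iInter fun j =>
      measurableSet_le (measurable_pathLoss hM hX hU j) (measurable_pathLoss hM hX hU n)
  refine measurable_to_countable' fun n => ?_
  have : S.serving M ⁻¹' {n} =
      ({ω | ∀ j, S.pathLoss M j ω ≤ S.pathLoss M n ω} ∩
        ⋂ m, ⋂ (_ : m < n), {ω | ∀ j, S.pathLoss M j ω ≤ S.pathLoss M m ω}ᶜ) ∪
      ({ω | n = 0} ∩ ⋂ m, {ω | ∀ j, S.pathLoss M j ω ≤ S.pathLoss M m ω}ᶜ) := by
    ext ω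
    simp only [mem_preimage, mem_singleton_iff, serving_eq_iff, mem_union, mem_inter_iff,
      mem_iInter, mem_compl_iff, mem_ofPred_eq]
  rw [this]
  exact ((hmax n).inter (MeasurableSet.iInter fun m => MeasurableSet.iInter fun _ =>
    (hmax m).compl)).union ((MeasurableSet.const _).inter
    (MeasurableSet.iInter fun m => (hmax m).compl))

lemma measurable_interference (hM : M.Valid) (hX : ∀ i, Measurable (S.X i))
    (hA : ∀ i, Measurable (S.active i)) (hU : ∀ i, Measurable (S.U i))
    (hh : ∀ i, Measurable (S.h i)) (P : ℝ) : Measurable (S.interference M P) := by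
  refine Measurable.tsum fun i => Measurable.ite ?_ ?_ measurable_const
  · exact (measurableSet_setOfPred.2 (hA i)).inter
      (measurableSet_eq_fun measurable_const (measurable_serving hM hX hU)).compl
  · exact (((measurable_pathLoss hM hX hU i).const_mul P).mul (hh i)).ennreal_ofReal

lemma measurable_fading (hM : M.Valid) (hX : ∀ i, Measurable (S.X i))
    (hU : ∀ i, Measurable (S.U i)) (hh : ∀ i, Measurable (S.h i)) :
    Measurable fun ω => S.h (S.serving M ω) ω := by
  have : Measurable fun p : ℕ × Ω => S.h p.1 p.2 :=
    measurable_from_prod_countable_right fun n => hh n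
  exact this.comp ((measurable_serving hM hX hU).prodMk measurable_id)

end Measurability

/-- The network on the space of deployments, LoS variables and fading gains. -/
def canonical : Network (((ℕ → Plane × Prop) × (ℕ → ℝ)) × (ℕ → ℝ)) where
  X i t := (t.1.1 i).1
  active i t := (t.1.1 i).2
  U i t := t.1.2 i
  h i t := t.2 i

variable {Ω : Type*} [MeasurableSpace Ω] {μ : Measure Ω} {S : Network Ω}

lemma Valid.hasLaw_h {q rho lam : ℝ} (hS : S.Valid μ q rho lam) (i : ℕ) :
    HasLaw (S.h i) (expMeasure 1) μ := by
  have := isProbabilityMeasure_expMeasure one_pos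
  refine ⟨(hS.measurable_h i).aemeasurable, ?_⟩
  have h := (hS.law_mark i).map_eq
  have h2 := congrArg (Measure.map Prod.snd) h
  rw [Measure.map_map measurable_snd ((hS.measurable_U i).prodMk (hS.measurable_h i)),
    Measure.map_snd_prod] at h2
  rw [show S.h i = Prod.snd ∘ fun ω => (S.U i ω, S.h i ω) from rfl, h2]
  simp

lemma Valid.iIndepFun_h {q rho lam : ℝ} (hS : S.Valid μ q rho lam) : iIndepFun S.h μ :=
  hS.indep_mark.comp (fun _ p => p.2) fun _ => measurable_snd

variable [IsProbabilityMeasure μ]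

lemma Valid.indepFun_U_h {q rho lam : ℝ} (hS : S.Valid μ q rho lam) (i : ℕ) :
    IndepFun (S.U i) (S.h i) μ := by
  have := isProbabilityMeasure_expMeasure one_pos
  rw [indepFun_iff_map_prod_eq_prod_map_map (hS.measurable_U i).aemeasurable
    (hS.measurable_h i).aemeasurable, (hS.law_mark i).map_eq, (hS.hasLaw_h i).map_eq]
  congr 1
  have h2 := congrArg (Measure.map Prod.fst) (hS.law_mark i).map_eq
  rw [Measure.map_map measurable_fst ((hS.measurable_U i).prodMk (hS.measurable_h i)),
    Measure.map_fst_prod] at h2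
  rw [show S.U i = Prod.fst ∘ fun ω => (S.U i ω, S.h i ω) from rfl, h2]
  simp

/-- The first component determines the serving index, so the fading gains stay i.i.d. exponential
after conditioning on which BS serves. -/
lemma Valid.indepFun_fading {q rho lam : ℝ} (hS : S.Valid μ q rho lam) :
    IndepFun (fun ω => ((fun i => (S.X i ω, S.active i ω)), fun i => S.U i ω))
      (fun ω i => S.h i ω) μ := by
  refine IndepFun.assoc
    (measurable_pi_lambda _ fun i => (hS.measurable_X i).prodMk (hS.measurable_active i))
    (measurable_pi_lambda _ hS.measurable_U) (measurable_pi_lambda _ hS.measurable_h) ?_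
    (indepFun_sequences hS.measurable_U hS.measurable_h hS.indep_mark hS.indepFun_U_h)
  refine hS.indep_deployment.comp (ψ := fun m => ((fun i => (m i).1), fun i => (m i).2))
    measurable_id ?_
  exact (measurable_pi_lambda _ fun i => measurable_fst.comp (measurable_pi_apply i)).prodMk
    (measurable_pi_lambda _ fun i => measurable_snd.comp (measurable_pi_apply i))

-- With positions, activity and LoS variables frozen, the serving index is a constant, and its
-- fading gain is an exponential variable absent from the interference.
open Classical in
lemma Valid.measure_lt_fading {q rho lam : ℝ} (hS : S.Valid μ q rho lam) (hM : M.Valid)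
    (P : ℝ) (c n : ℝ≥0∞) :
    μ {ω | c * (S.interference M P ω + n) < ENNReal.ofReal (S.h (S.serving M ω) ω)}
      = ∫⁻ ω, nexp (c * (S.interference M P ω + n)) ∂μ := by
  let D : Ω → (ℕ → Plane × Prop) × (ℕ → ℝ) :=
    fun ω => ((fun i => (S.X i ω, S.active i ω)), fun i => S.U i ω)
  let H : Ω → ℕ → ℝ := fun ω i => S.h i ω
  have hD : Measurable D :=
    (measurable_pi_lambda _ fun i => (hS.measurable_X i).prodMk (hS.measurable_active i)).prodMk
      (measurable_pi_lambda _ hS.measurable_U)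
  have hH : Measurable H := measurable_pi_lambda _ hS.measurable_h
  -- On the canonical space, event and integrand are jointly measurable in the frozen data and the
  -- fading gains, as Fubini requires.
  have cX : ∀ i, Measurable (canonical.X i) := fun i =>
    measurable_fst.comp ((measurable_pi_apply i).comp (measurable_fst.comp measurable_fst))
  have cA : ∀ i, Measurable (canonical.active i) := fun i =>
    measurable_snd.comp ((measurable_pi_apply i).comp (measurable_fst.comp measurable_fst))
  have cU : ∀ i, Measurable (canonical.U i) := fun i =>
    (measurable_pi_apply i).comp (measurable_snd.comp measurable_fst)
  have ch : ∀ i, Measurable (canonical.h i) := fun i =>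
    (measurable_pi_apply i).comp measurable_snd
  have hI : Measurable fun t => c * (canonical.interference M P t + n) :=
    ((measurable_interference hM cX cA cU ch P).add_const n).const_mul c
  have hf := measurable_fading hM cX cU ch
  have hlt : MeasurableSet {t | c * (canonical.interference M P t + n) <
      ENNReal.ofReal (canonical.h (canonical.serving M t) t)} :=
    measurableSet_lt hI hf.ennreal_ofReal
  have hset : MeasurableSet {ω | c * (S.interference M P ω + n) <
      ENNReal.ofReal (S.h (S.serving M ω) ω)} := (hD.prodMk hH) hlt
  rw [← lintegral_indicator_one hset]
  refine (lintegral_indepFun hD hH hS.indepFun_fading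
    (f := fun e v => {t | c * (canonical.interference M P t + n) <
      ENNReal.ofReal (canonical.h (canonical.serving M t) t)}.indicator 1 (e, v))
    (measurable_one.indicator hlt)).trans (Eq.trans ?_ (lintegral_indepFun hD hH hS.indepFun_fading
    (f := fun e v => nexp (c * (canonical.interference M P (e, v) + n)))
    (measurable_nexp.comp hI)).symm)
  refine lintegral_congr fun ω => ?_
  have hG : Measurable fun v : ℕ → ℝ => c * (canonical.interference M P (D ω, v) + n) :=
    hI.comp measurable_prodMk_left
  -- Changing the serving gain moves neither the serving index, which does not see fading, nor any
  -- term of the sum, which omits that index.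
  have hGb : ∀ (v : ℕ → ℝ) (x : ℝ),
      c * (canonical.interference M P (D ω, Function.update v (S.serving M ω) x) + n)
        = c * (canonical.interference M P (D ω, v) + n) := by
    intro v x
    congr 2
    refine tsum_congr fun i => ?_
    by_cases hi : i = S.serving M ω
    · rw [if_neg (fun h => h.2 hi), if_neg (fun h => h.2 hi)]
    · have : canonical.h i (D ω, Function.update v (S.serving M ω) x) = canonical.h i (D ω, v) :=
        Function.update_of_ne hi _ _
      rw [this]
      rfl
  have hlt' : MeasurableSet {ω' | c * (canonical.interference M P (D ω, fun i => S.h i ω') + n) <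
      ENNReal.ofReal (S.h (S.serving M ω) ω')} :=
    measurableSet_lt (hG.comp hH) (hS.measurable_h _).ennreal_ofReal
  rw [← measure_lt_exponential hS.measurable_h hS.iIndepFun_h (hS.hasLaw_h (S.serving M ω)) hG hGb,
    ← lintegral_indicator_one hlt']
  rfl

/-- Solving the SINR inequality for the fading gain reduces this to `measure_lt_fading`. The
rearrangement remains valid in `[0, ∞]` when interference plus noise is `0` or `∞`. -/
lemma Valid.measure_lt_sinrWith {q rho lam : ℝ} (hS : S.Valid μ q rho lam) (hM : M.Valid)
    {P PN z g : ℝ} (hP : 0 < P) (hz : 0 < z) (hg : 0 < g) :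
    μ {ω | ENNReal.ofReal g < S.sinrWith M P PN z ω}
      = ∫⁻ ω, nexp (ENNReal.ofReal (g / (P * z)) *
          (S.interference M P ω + ENNReal.ofReal PN)) ∂μ := by
  rw [← hS.measure_lt_fading hM]
  congr 1
  ext ω
  have hPz : 0 < P * z := mul_pos hP hz
  simp only [mem_ofPred_eq, sinrWith]
  rw [ENNReal.lt_div_iff_mul_lt (Or.inr ENNReal.ofReal_ne_top)
    (Or.inr (ENNReal.ofReal_pos.2 hg).ne'), ENNReal.ofReal_mul hPz.le,
    ENNReal.ofReal_div_of_pos hPz, mul_comm (ENNReal.ofReal g / _), ← mul_div_assoc,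
    ENNReal.div_lt_iff (Or.inl (ENNReal.ofReal_pos.2 hPz).ne') (Or.inl ENNReal.ofReal_ne_top),
    mul_comm (ENNReal.ofReal g), mul_comm (ENNReal.ofReal (P * z))]

end Network

/-! ### Where strong links can originate -/

namespace PathLoss

variable {k : ℕ} {M : PathLoss k}

/-- The positions from which a path loss of at least `z` is possible. -/
def strongRegion (M : PathLoss k) (z : ℝ) : Set Plane :=
  {x | z ≤ M.zetaL (M.dist3 ‖x‖) ∨ z ≤ M.zetaNL (M.dist3 ‖x‖)}

lemma measurableSet_strongRegion (M : PathLoss k) (z : ℝ) : MeasurableSet (M.strongRegion z) := by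
  have h1 : Measurable fun x : Plane => M.zetaL (M.dist3 ‖x‖) :=
    (M.measurable_zetaL.comp M.measurable_dist3).comp measurable_norm
  have h2 : Measurable fun x : Plane => M.zetaNL (M.dist3 ‖x‖) :=
    (M.measurable_zetaNL.comp M.measurable_dist3).comp measurable_norm
  exact (measurableSet_le measurable_const h1).union (measurableSet_le measurable_const h2)

lemma mem_strongRegion_of_le_gain {z u : ℝ} {x : Plane} (h : z ≤ M.gain ‖x‖ u) :
    x ∈ M.strongRegion z := by
  unfold gain at h
  split_ifs at h
  exacts [Or.inl h, Or.inr h]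

lemma le_dist3_self (M : PathLoss k) (r : ℝ) : r ≤ M.dist3 r := by
  apply Real.le_sqrt_of_sq_le
  nlinarith [sq_nonneg M.L]

/-- Each of the finitely many power laws tends to zero, so far away none reaches `z`, whichever
piece applies. -/
lemma Valid.isBounded_strongRegion (hM : M.Valid) {z : ℝ} (hz : 0 < z) :
    Bornology.IsBounded (M.strongRegion z) := by
  have hlim : ∀ A a : ℝ, 0 < a → ∀ᶠ w : ℝ in atTop, A * w ^ (-a) < z := fun A a ha => by
    have h := (tendsto_rpow_neg_atTop ha).const_mul A
    rw [mul_zero] at h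
    exact h.eventually (gt_mem_nhds hz)
  have h1 : ∀ᶠ w : ℝ in atTop, ∀ n, M.zetaPieceL n w < z :=
    eventually_all.2 fun n => hlim _ _ (hM.aL_pos n)
  have h2 : ∀ᶠ w : ℝ in atTop, ∀ n, M.zetaPieceNL n w < z :=
    eventually_all.2 fun n => hlim _ _ (hM.aNL_pos n)
  obtain ⟨W, hW⟩ := eventually_atTop.1 (h1.and h2)
  refine (Metric.isBounded_closedBall (x := (0 : Plane)) (r := W)).subset fun x hx => ?_
  rw [mem_closedBall_zero_iff]
  by_contra hlt
  have hw := hW _ ((not_le.1 hlt).le.trans (M.le_dist3_self ‖x‖))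
  rcases hx with hx | hx
  · exact absurd hx (not_le.2 (hw.1 _))
  · exact absurd hx (not_le.2 (hw.2 _))

lemma dist3_strictMonoOn (M : PathLoss k) : StrictMonoOn M.dist3 (Ici 0) := by
  intro a ha b hb hab
  apply Real.sqrt_lt_sqrt (by positivity)
  have : a ^ 2 < b ^ 2 := pow_lt_pow_left₀ hab ha two_ne_zero
  linarith

/-- A power law is injective in the distance, so a nonempty level set lies on a circle about the
origin. -/
lemma Valid.volume_level_eq_zero (hM : M.Valid) {A a c : ℝ} (hA : 0 < A) (ha : 0 < a) :
    volume {x : Plane | A * M.dist3 ‖x‖ ^ (-a) = c} = 0 := by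
  rcases Set.eq_empty_or_nonempty {x : Plane | A * M.dist3 ‖x‖ ^ (-a) = c} with h | ⟨y, hy⟩
  · rw [h, measure_empty]
  · refine measure_mono_null (fun x hx => ?_) (Measure.addHaar_sphere volume (0 : Plane) ‖y‖)
    rw [mem_sphere_zero_iff_norm]
    have hp : ∀ r, 0 < M.dist3 r := fun r => hM.L_pos.trans_le (M.le_dist3 r)
    have h1 : M.dist3 ‖x‖ ^ (-a) = M.dist3 ‖y‖ ^ (-a) :=
      mul_left_cancel₀ hA.ne' (Eq.trans hx (Eq.symm hy))
    have h2 : M.dist3 ‖x‖ = M.dist3 ‖y‖ :=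
      (Real.rpow_left_inj (hp _).le (hp _).le (neg_ne_zero.2 ha.ne')).1 h1
    exact M.dist3_strictMonoOn.injOn (norm_nonneg x) (norm_nonneg y) h2

/-- The region from which a path loss close to the largest one is possible has small area. -/
lemma Valid.exists_volume_strongRegion_le (hM : M.Valid) {ζ : ℝ} (hζ : 0 < ζ)
    (hL : ∀ w, M.L ≤ w → M.zetaL w ≤ ζ) (hNL : ∀ w, M.L ≤ w → M.zetaNL w ≤ ζ)
    {ε : ℝ≥0∞} (hε : 0 < ε) :
    ∃ z, 0 < z ∧ z < ζ ∧ volume (M.strongRegion z) ≤ ε := by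
  obtain ⟨u, hu, hu1, hulim⟩ := exists_seq_strictMono_tendsto' hζ
  have hanti : Antitone fun n => M.strongRegion (u n) := by
    intro m n hmn x hx
    exact hx.imp (hu.monotone hmn).trans (hu.monotone hmn).trans
  have hlim := tendsto_measure_iInter_atTop (μ := volume)
    (fun n => (M.measurableSet_strongRegion (u n)).nullMeasurableSet) hanti
    ⟨0, (hM.isBounded_strongRegion (hu1 0).1).measure_lt_top.ne⟩
  -- By domination no path loss exceeds `ζ`, so a point in all the regions attains `ζ` exactly in
  -- one of finitely many power laws.
  have hnull : volume (⋂ n, M.strongRegion (u n)) = 0 := by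
    refine measure_mono_null (t := ⋃ n, ({x : Plane | M.AL n * M.dist3 ‖x‖ ^ (-(M.aL n)) = ζ} ∪
      {x : Plane | M.ANL n * M.dist3 ‖x‖ ^ (-(M.aNL n)) = ζ})) (fun x hx => ?_) ?_
    · rw [mem_iInter] at hx
      refine mem_iUnion.2 ⟨M.piece (M.dist3 ‖x‖), ?_⟩
      by_contra hcon
      rw [mem_union, not_or] at hcon
      have h1 := lt_of_le_of_ne (hL _ (M.le_dist3 ‖x‖)) hcon.1
      have h2 := lt_of_le_of_ne (hNL _ (M.le_dist3 ‖x‖)) hcon.2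
      obtain ⟨n, hn⟩ := (hulim.eventually (lt_mem_nhds (max_lt h1 h2))).exists
      rcases hx n with h | h
      · exact absurd h (not_le.2 ((le_max_left _ _).trans_lt hn))
      · exact absurd h (not_le.2 ((le_max_right _ _).trans_lt hn))
    · exact measure_iUnion_null fun n => measure_union_null
        (hM.volume_level_eq_zero (hM.AL_pos n) (hM.aL_pos n))
        (hM.volume_level_eq_zero (hM.ANL_pos n) (hM.aNL_pos n))
  rw [hnull] at hlim
  obtain ⟨n, hn⟩ := (hlim.eventually (gt_mem_nhds hε)).exists
  exact ⟨u n, (hu1 n).1, (hu1 n).2, hn.le⟩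

/-- Near the typical user, links are LoS with probability bounded below, and then have a path loss
close to the largest one. -/
lemma Valid.exists_radius (hM : M.Valid) (hLoS : ∃ w, M.L < w ∧ M.piece w = 0 ∧ 0 < M.prL 0 w)
    {z : ℝ} (hz : z < M.zetaPieceL 0 M.L) :
    ∃ ε > 0, ∃ p ∈ Ioo (0 : ℝ) 1, ∀ r u, 0 ≤ r → r < ε → u < p → z ≤ M.gain r u := by
  obtain ⟨w, hLw, hw0, hpw⟩ := hLoS
  have hpiece : ∀ v, v ≤ w → M.piece v = 0 := fun v hv =>
    le_antisymm (hw0 ▸ M.monotone_piece hv) (Fin.zero_le _)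
  have hc : ContinuousAt M.dist3 0 := by
    unfold dist3
    fun_prop
  have hd0 : M.dist3 0 = M.L := by
    rw [dist3, zero_pow two_ne_zero, zero_add, Real.sqrt_sq hM.L_pos.le]
  have hcz : ContinuousAt (M.zetaPieceL 0) (M.dist3 0) := by
    rw [hd0]
    exact continuousAt_const.mul (Real.continuousAt_rpow_const _ _ (Or.inl hM.L_pos.ne'))
  have h1 : ∀ᶠ r in 𝓝 (0 : ℝ), M.dist3 r < w := hc.eventually (gt_mem_nhds (by rwa [hd0]))
  have h2 : ∀ᶠ r in 𝓝 (0 : ℝ), z < M.zetaPieceL 0 (M.dist3 r) :=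
    (hcz.comp hc).eventually (lt_mem_nhds (by simpa [hd0] using hz))
  obtain ⟨ε, hε, hball⟩ := Metric.eventually_nhds_iff.1 (h1.and h2)
  have hp1 : M.prL 0 w ≤ 1 := (hM.prL_mem 0 w hLw.le hw0).2
  -- By antitonicity, every distance below `w` has LoS probability at least `prL 0 w`; halving keeps
  -- `p` strictly below one.
  refine ⟨ε, hε, M.prL 0 w / 2, ⟨by linarith, by linarith⟩, fun r u hr hrε hu => ?_⟩
  obtain ⟨hrw, hrz⟩ := hball (y := r) (by rwa [Real.dist_eq, sub_zero, abs_of_nonneg hr])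
  have hp := hpiece _ hrw.le
  have hpr : M.prL 0 w ≤ M.PrL (M.dist3 r) := by
    rw [PrL, hp]
    exact hM.prL_anti 0 ⟨M.le_dist3 r, hp⟩ ⟨hLw.le, hw0⟩ hrw.le
  rw [gain, if_pos (by linarith), zetaL, hp]
  exact hrz.le

end PathLoss

/-! ### Void probabilities and existence of a strongest link -/

lemma one_sub_nexp_le (x : ℝ≥0∞) : 1 - nexp x ≤ x := by
  by_cases h : x = ∞
  · simp [h]
  · rw [← ENNReal.ofReal_toReal h, nexp_coe_real _ ENNReal.toReal_nonneg, ← ENNReal.ofReal_one,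
      ← ENNReal.ofReal_sub _ (Real.exp_pos _).le]
    apply ENNReal.ofReal_le_ofReal
    linarith [Real.add_one_le_exp (-x.toReal)]

namespace Network

variable {k : ℕ} {M : PathLoss k} {Ω : Type*} [MeasurableSpace Ω] {μ : Measure Ω}
  {S : Network Ω} {q rho lam : ℝ}

/-- Almost surely only finitely many BSs lie in the bounded region, so once some link reaches `z` a
maximum is attained and `serving` is a true maximiser rather than the default value of `sInf`. -/
lemma Valid.ae_le_pathLoss_serving (hS : S.Valid μ q rho lam) (hM : M.Valid) {z : ℝ} (hz : 0 < z) :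
    ∀ᵐ ω ∂μ, (∃ i, z ≤ S.pathLoss M i ω) → z ≤ S.pathLoss M (S.serving M ω) ω := by
  have hfin : ∀ᵐ ω ∂μ, S.count (M.strongRegion z) ω ≠ ⊤ := by
    have hl := hS.hppp.law _ (M.measurableSet_strongRegion z) (hM.isBounded_strongRegion hz)
    rw [hl.ae_iff (p := fun n => n ≠ ⊤) Measurable.of_discrete,
      ae_map_iff Measurable.of_discrete.aemeasurable MeasurableSet.of_discrete]
    exact ae_of_all _ fun n => ENat.natCast_ne_top n
  filter_upwards [hfin] with ω hω ⟨i, hi⟩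
  have hfin' : {i | z ≤ S.pathLoss M i ω}.Finite :=
    (Set.encard_ne_top_iff.1 hω).subset fun j hj => PathLoss.mem_strongRegion_of_le_gain hj
  obtain ⟨j, hj, hmax⟩ := Set.exists_max_image _ (fun i => S.pathLoss M i ω) hfin' ⟨i, hi⟩
  have hj' : ∀ n, S.pathLoss M n ω ≤ S.pathLoss M j ω := fun n => by
    by_cases hn : z ≤ S.pathLoss M n ω
    · exact hmax n hn
    · exact (not_le.1 hn).le.trans hj
  have hserv : S.serving M ω ∈ {i : ℕ | ∀ j, S.pathLoss M j ω ≤ S.pathLoss M i ω} :=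
    Nat.sInf_mem ⟨j, hj'⟩
  exact le_trans hj (hserv j)

variable [IsProbabilityMeasure μ]

/-- The Laplace functional of the function equal to `∞` on `R` and `0` elsewhere is the void
probability, and `1 - exp (-x) ≤ x`. -/
lemma Valid.measure_exists_active_le (hS : S.Valid μ q rho lam)
    (hd : 0 ≤ activeDensity q rho lam) {R : Set Plane} (hR : MeasurableSet R) :
    μ {ω | ∃ i, S.active i ω ∧ S.X i ω ∈ R}
      ≤ ENNReal.ofReal (activeDensity q rho lam) * volume R := by
  classical
  have key := lintegral_nexp_hppp hS.hppp_active hd hS.measurable_X hS.measurable_active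
    (measurable_const.indicator hR : Measurable (R.indicator fun _ => (∞ : ℝ≥0∞)))
  have h1 : ∀ x, 1 - nexp (R.indicator (fun _ => (∞ : ℝ≥0∞)) x) = R.indicator 1 x := by
    intro x
    by_cases hx : x ∈ R <;> simp [hx, nexp_top, nexp_zero]
  simp_rw [h1] at key
  rw [lintegral_indicator_one hR] at key
  set E : Set Ω := {ω | ∃ i, S.active i ω ∧ S.X i ω ∈ R}
  have hE : MeasurableSet E := by
    have : E = ⋃ i, {ω | S.active i ω} ∩ S.X i ⁻¹' R := by
      ext ω
      simp [E]
    rw [this]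
    exact MeasurableSet.iUnion fun i =>
      (measurableSet_setOfPred.2 (hS.measurable_active i)).inter (hS.measurable_X i hR)
  have h2 : ∀ ω, nexp (∑' i, if S.active i ω then R.indicator (fun _ => (∞ : ℝ≥0∞)) (S.X i ω)
      else 0) = Eᶜ.indicator 1 ω := by
    intro ω
    by_cases hω : ω ∈ E
    · rw [indicator_of_notMem (notMem_compl_iff.2 hω)]
      obtain ⟨i, hi, hx⟩ := hω
      rw [ENNReal.tsum_eq_top_of_eq_top ⟨i, by simp [hi, hx]⟩, nexp_top]
    · rw [indicator_of_mem hω, ENNReal.tsum_eq_zero.2, nexp_zero]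
      · rfl
      · intro i
        by_cases hi : S.active i ω
        · rw [if_pos hi, indicator_of_notMem fun hx => hω ⟨i, hi, hx⟩]
        · rw [if_neg hi]
  simp_rw [h2] at key
  rw [lintegral_indicator_one hE.compl] at key
  have h3 : μ E = 1 - μ Eᶜ := by
    rw [← prob_compl_eq_one_sub hE.compl, compl_compl]
  rw [h3, key]
  exact one_sub_nexp_le _

lemma one_sub_lintegral_nexp_ite {p : ℝ} (hp : p ∈ Ioo (0 : ℝ) 1) :
    1 - ∫⁻ b : ℝ × ℝ, nexp (if b.1 < p then ∞ else 0)
      ∂(volume.restrict (Icc (0 : ℝ) 1)).prod (expMeasure 1) = ENNReal.ofReal p := by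
  have := isProbabilityMeasure_expMeasure one_pos
  have h : ∀ b : ℝ × ℝ, nexp (if b.1 < p then ∞ else 0) = if b.1 < p then 0 else 1 := by
    intro b
    split_ifs
    exacts [nexp_top, nexp_zero]
  have hm : Measurable fun b : ℝ × ℝ => if b.1 < p then (0 : ℝ≥0∞) else 1 :=
    Measurable.ite (measurableSet_lt measurable_fst measurable_const) measurable_const
      measurable_const
  simp_rw [h]
  rw [lintegral_prod _ hm.aemeasurable]
  have hin : ∀ u : ℝ, ∫⁻ y : ℝ, (if (u, y).1 < p then (0 : ℝ≥0∞) else 1) ∂expMeasure 1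
      = if u < p then 0 else 1 := by
    intro u
    by_cases hu : u < p <;> simp [hu]
  simp_rw [hin]
  rw [PathLoss.lintegral_uniform_ite ⟨hp.1.le, hp.2.le⟩, mul_zero, zero_add, mul_one,
    ← ENNReal.ofReal_one, ← ENNReal.ofReal_sub _ (by linarith [hp.2])]
  congr 1
  ring

-- Points within `ε` whose LoS variable is below `p` form a thinned process, and each would give a
-- link of strength `z`. Assigning `∞` to such marked points turns the marked Laplace functional
-- into its void probability.
open Classical in
lemma Valid.measure_no_strong_link_le (hS : S.Valid μ q rho lam) (hlam : 0 ≤ lam)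
    {z ε p : ℝ} (hp : p ∈ Ioo (0 : ℝ) 1)
    (h : ∀ r u, 0 ≤ r → r < ε → u < p → z ≤ M.gain r u) :
    μ {ω | ∀ i, S.pathLoss M i ω < z} ≤
      nexp (ENNReal.ofReal lam * (ENNReal.ofReal p * volume (Metric.ball (0 : Plane) ε))) := by
  have := isProbabilityMeasure_expMeasure one_pos
  have hunif : IsProbabilityMeasure (volume.restrict (Icc (0 : ℝ) 1)) := ⟨by simp⟩
  obtain ⟨F, hFeq⟩ : ∃ F : Plane → ℝ × ℝ → ℝ≥0∞,
      ∀ x b, F x b = if ‖x‖ < ε ∧ b.1 < p then ∞ else 0 := ⟨_, fun _ _ => rfl⟩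
  have hF : Measurable (Function.uncurry F) := by
    rw [show Function.uncurry F = fun q : Plane × ℝ × ℝ => if ‖q.1‖ < ε ∧ q.2.1 < p then ∞ else 0
      from funext fun q => hFeq _ _]
    refine Measurable.ite ?_ measurable_const measurable_const
    exact (measurableSet_lt measurable_fst.norm measurable_const).inter
      (measurableSet_lt (measurable_fst.comp measurable_snd) measurable_const)
  have hppp : IsHPPP (fun B ω => {i | (fun _ _ => True : ℕ → Ω → Prop) i ω ∧ S.X i ω ∈ B}.encard)
      lam μ := by
    have := hS.hppp
    unfold count at this
    simpa using this
  have hind : IndepFun (fun ω i => (S.X i ω, (fun _ _ => True : ℕ → Ω → Prop) i ω))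
      (fun ω i => (S.U i ω, S.h i ω)) μ :=
    hS.indep_deployment.comp (φ := fun d i => ((d i).1, True))
      (measurable_pi_lambda _ fun i =>
        (measurable_fst.comp (measurable_pi_apply i)).prodMk measurable_const) measurable_id
  have key := lintegral_nexp_marked hppp hlam hS.measurable_X (fun _ => measurable_const)
    (fun i => (hS.measurable_U i).prodMk (hS.measurable_h i)) hS.law_mark hS.indep_mark hind hF
  have hmark : ∀ x, 1 - ∫⁻ b, nexp (F x b) ∂(volume.restrict (Icc (0 : ℝ) 1)).prod (expMeasure 1)
      = (Metric.ball (0 : Plane) ε).indicator (fun _ => ENNReal.ofReal p) x := by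
    intro x
    by_cases hx : ‖x‖ < ε
    · rw [indicator_of_mem (mem_ball_zero_iff.2 hx), ← one_sub_lintegral_nexp_ite hp]
      simp only [hFeq, hx, true_and]
    · rw [indicator_of_notMem (fun h' => hx (mem_ball_zero_iff.1 h'))]
      simp [hFeq, hx, nexp_zero]
  simp_rw [hmark] at key
  simp only [if_true] at key
  rw [lintegral_indicator_const measurableSet_ball] at key
  rw [← key]
  set f : Ω → ℝ≥0∞ := fun ω => nexp (∑' i, F (S.X i ω) (S.U i ω, S.h i ω))
    with hf
  have hm : Measurable f := by
    refine measurable_nexp.comp (Measurable.tsum fun i => ?_)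
    exact hF.comp ((hS.measurable_X i).prodMk ((hS.measurable_U i).prodMk (hS.measurable_h i)))
  have hge := mul_meas_ge_le_lintegral (μ := μ) hm 1
  rw [one_mul] at hge
  refine le_trans (measure_mono fun ω hω => ?_) hge
  rw [mem_ofPred_eq, hf]
  dsimp only
  rw [ENNReal.tsum_eq_zero.2, nexp_zero]
  intro i
  rw [hFeq]
  refine if_neg fun hi => ?_
  exact absurd (h _ _ (norm_nonneg _) hi.1 hi.2) (not_le.2 (hω i))

end Network

/-! ### Limit of the active density and elementary estimates -/

lemma activeDensity_nonneg {q rho lam : ℝ} (hq : 0 < q) (hrho : 0 < rho) (hlam : 0 < lam) :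
    0 ≤ activeDensity q rho lam := by
  refine mul_nonneg hlam.le (sub_nonneg.2 ?_)
  have h : (1 : ℝ) ≤ 1 + rho / (q * lam) := by
    have : 0 < rho / (q * lam) := by positivity
    linarith
  exact div_le_one_of_le₀ (Real.one_le_rpow h hq.le) (by positivity)

/-- With `t = 1 / lam`, the density is minus the difference quotient at `0` of `(1 + rho * t / q) ^
(-q)`, whose derivative there is `-rho`. -/
lemma tendsto_activeDensity {q rho : ℝ} (hq : 0 < q) :
    Tendsto (fun lam => activeDensity q rho lam) atTop (𝓝 rho) := by
  let f : ℝ → ℝ := fun t => 1 / (1 + rho / q * t) ^ q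
  have h0 : HasDerivAt f (-rho) 0 := by
    have h1 : HasDerivAt (fun t : ℝ => 1 + rho / q * t) (rho / q) 0 := by
      simpa using ((hasDerivAt_id (0 : ℝ)).const_mul (rho / q)).const_add 1
    have h2 := h1.rpow_const (p := q) (Or.inl (by simp))
    have h3 := h2.inv (by simp)
    have hf : f = (fun t => (1 + rho / q * t) ^ q)⁻¹ := by
      ext t
      simp [f]
    have hd : -(rho / q * q * (1 + rho / q * 0) ^ (q - 1)) / ((1 + rho / q * 0) ^ q) ^ 2 = -rho := by
      simp only [mul_zero, add_zero, Real.one_rpow, one_pow, div_one, mul_one]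
      field_simp
    rwa [hf, ← hd]
  have h4 := (hasDerivAt_iff_tendsto_slope_zero.1 h0).mono_left (nhdsGT_le_nhdsNE 0)
  have h5 := (h4.comp tendsto_inv_atTop_nhdsGT_zero).neg
  rw [neg_neg] at h5
  refine h5.congr' ?_
  filter_upwards [eventually_gt_atTop 0] with lam hlam
  simp only [Function.comp_apply, f, activeDensity, smul_eq_mul, inv_inv, zero_add, mul_zero,
    add_zero, Real.one_rpow, div_one]
  rw [show rho / q * lam⁻¹ = rho / (q * lam) by field_simp]
  ring

lemma tendsto_of_le_add {α : Type*} {l : Filter α} {a b : α → ℝ≥0∞} {c : ℝ≥0∞}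
    (ha : Tendsto a l (𝓝 c)) (hc : c ≠ ∞) (h1 : ∀ ε > 0, ∀ᶠ x in l, a x ≤ b x + ε)
    (h2 : ∀ ε > 0, ∀ᶠ x in l, b x ≤ a x + ε) : Tendsto b l (𝓝 c) := by
  rw [ENNReal.tendsto_nhds hc] at ha ⊢
  intro ε hε
  have hε2 : 0 < ε / 2 := ENNReal.half_pos hε.ne'
  filter_upwards [ha _ hε2, h1 _ hε2, h2 _ hε2] with x hx h1x h2x
  constructor
  · rw [tsub_le_iff_right]
    calc c ≤ a x + ε / 2 := tsub_le_iff_right.1 hx.1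
      _ ≤ b x + ε / 2 + ε / 2 := by gcongr
      _ = b x + ε := by rw [add_assoc, ENNReal.add_halves]
  · calc b x ≤ a x + ε / 2 := h2x
      _ ≤ c + ε / 2 + ε / 2 := by gcongr; exact hx.2
      _ = c + ε := by rw [add_assoc, ENNReal.add_halves]

/-- The difference is at most `(t - 1) * x * exp (-x)`, and `x * exp (-x) ≤ 1`. The error is uniform
in `a`, so no control of the interference is needed when the serving path loss is perturbed. -/
lemma nexp_le_nexp_mul_add {t : ℝ} (ht : 1 ≤ t) (a : ℝ≥0∞) :
    nexp a ≤ nexp (ENNReal.ofReal t * a) + ENNReal.ofReal (t - 1) := by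
  by_cases h : a = ∞
  · simp [h, nexp_top]
  · have ha : 0 ≤ a.toReal := ENNReal.toReal_nonneg
    have ht0 : 0 ≤ t := by linarith
    rw [← ENNReal.ofReal_toReal h, ← ENNReal.ofReal_mul ht0, nexp_coe_real _ ha,
      nexp_coe_real _ (mul_nonneg ht0 ha), ← ENNReal.ofReal_add (Real.exp_pos _).le (by linarith)]
    apply ENNReal.ofReal_le_ofReal
    generalize a.toReal = x at ha
    have h1 : Real.exp (-(t * x)) = Real.exp (-x) * Real.exp (-((t - 1) * x)) := by
      rw [← Real.exp_add]
      ring_nf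
    have h2 := Real.add_one_le_exp (-((t - 1) * x))
    have h3 : x * Real.exp (-x) ≤ 1 := by
      have h4 : x ≤ Real.exp x := by linarith [Real.add_one_le_exp x]
      calc x * Real.exp (-x) ≤ Real.exp x * Real.exp (-x) := by gcongr
        _ = 1 := by rw [← Real.exp_add]; simp
    have h5 : Real.exp (-x) * (1 - (t - 1) * x) ≤ Real.exp (-x) * Real.exp (-((t - 1) * x)) := by
      gcongr
      linarith
    rw [h1]
    nlinarith [mul_le_mul_of_nonneg_left h3 (by linarith : 0 ≤ t - 1)]

namespace PathLoss

variable {k : ℕ} {M : PathLoss k}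

lemma limitLaplace_eq (M : PathLoss k) (P s : ℝ) {rho : ℝ} (hrho : 0 ≤ rho) :
    M.limitLaplace P rho s = (nexp (ENNReal.ofReal rho *
      (ENNReal.ofReal (2 * Real.pi) * (M.integralL P s + M.integralNL P s)))).toReal := by
  rw [limitLaplace, expNeg_eq, expNeg_eq, ← ENNReal.toReal_mul, ← nexp_add, ← mul_add,
    ← mul_assoc, ← ENNReal.ofReal_mul hrho, mul_comm rho]

end PathLoss

/-! ### Estimates at a fixed density -/

namespace Network

section Single

variable {k : ℕ} {M : PathLoss k} {Ω : Type*} [MeasurableSpace Ω] {μ : Measure Ω}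
  {S : Network Ω} {q rho lam : ℝ}

lemma interference_le_totalPower {Ω : Type*} (S : Network Ω) (M : PathLoss k) (P : ℝ) (ω : Ω) :
    S.interference M P ω ≤ S.totalPower M P ω := by
  refine ENNReal.tsum_le_tsum fun i => ?_
  split_ifs with h1 h2 h2
  exacts [le_rfl, absurd h1.1 h2, zero_le, le_rfl]

lemma interference_eq_totalPower {Ω : Type*} {S : Network Ω} {M : PathLoss k} {ω : Ω}
    (h : ¬ S.active (S.serving M ω) ω) (P : ℝ) :
    S.interference M P ω = S.totalPower M P ω := by
  refine tsum_congr fun i => ?_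
  by_cases hi : S.active i ω
  · rw [if_pos hi, if_pos ⟨hi, fun h' => h (h' ▸ hi)⟩]
  · rw [if_neg hi, if_neg fun h' => hi h'.1]

/-- Both integrands agree unless the serving BS is active, and there the left one is at most `1`. -/
lemma Valid.lintegral_nexp_interference_le (hS : S.Valid μ q rho lam) (hM : M.Valid) (P s : ℝ) :
    ∫⁻ ω, nexp (ENNReal.ofReal s * S.interference M P ω) ∂μ
      ≤ ∫⁻ ω, nexp (ENNReal.ofReal s * S.totalPower M P ω) ∂μ
        + μ {ω | S.active (S.serving M ω) ω} := by
  have hact : MeasurableSet {ω | S.active (S.serving M ω) ω} := by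
    have h : Measurable fun p : ℕ × Ω => S.active p.1 p.2 :=
      measurable_from_prod_countable_right fun n => hS.measurable_active n
    exact measurableSet_setOfPred.2 (h.comp
      ((measurable_serving hM hS.measurable_X hS.measurable_U).prodMk measurable_id))
  rw [← lintegral_indicator_one hact, ← lintegral_add_right _ (measurable_one.indicator hact)]
  refine lintegral_mono fun ω => ?_
  by_cases hω : ω ∈ {ω | S.active (S.serving M ω) ω}
  · rw [indicator_of_mem hω]
    exact (nexp_le_one _).trans le_add_self
  · rw [interference_eq_totalPower hω]
    exact le_self_add

/-- Either no link reaches `z`, or the serving BS lies in the strong region; if it is also active,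
that region contains an active BS. -/
lemma Valid.measure_active_serving_le [IsProbabilityMeasure μ] (hS : S.Valid μ q rho lam)
    (hM : M.Valid) (hd : 0 ≤ activeDensity q rho lam) {z : ℝ} (hz : 0 < z) :
    μ {ω | S.active (S.serving M ω) ω} ≤ μ {ω | ∀ i, S.pathLoss M i ω < z}
      + ENNReal.ofReal (activeDensity q rho lam) * volume (M.strongRegion z) := by
  refine le_trans ?_ (add_le_add_right
    (hS.measure_exists_active_le hd (M.measurableSet_strongRegion z)) _)
  refine le_trans (measure_mono_ae ?_) (measure_union_le _ _)
  filter_upwards [hS.ae_le_pathLoss_serving hM hz] with ω hω hact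
  by_cases h : ∃ i, z ≤ S.pathLoss M i ω
  · exact Or.inr ⟨_, hact, PathLoss.mem_strongRegion_of_le_gain (hω h)⟩
  · exact Or.inl fun i => not_le.1 fun hi => h ⟨i, hi⟩

lemma Valid.laplace_eq (hS : S.Valid μ q rho lam) (hM : M.Valid) (P s : ℝ) :
    S.laplace M μ P s = (∫⁻ ω, nexp (ENNReal.ofReal s * S.interference M P ω) ∂μ).toReal := by
  have hm : Measurable fun ω => nexp (ENNReal.ofReal s * S.interference M P ω) :=
    measurable_nexp.comp ((measurable_interference hM hS.measurable_X hS.measurable_active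
      hS.measurable_U hS.measurable_h P).const_mul _)
  rw [laplace]
  simp_rw [expNeg_eq]
  exact integral_toReal hm.aemeasurable (ae_of_all _ fun ω => (nexp_ne_top _).lt_top)

lemma sinrWith_mono {Ω : Type*} (S : Network Ω) (M : PathLoss k) {P z z' : ℝ} (hP : 0 < P)
    (PN : ℝ) (hz : 0 ≤ z) (hzz' : z ≤ z') (ω : Ω) :
    S.sinrWith M P PN z ω ≤ S.sinrWith M P PN z' ω := by
  refine ENNReal.div_le_div_right ?_ _
  rw [ENNReal.ofReal_mul (by positivity), ENNReal.ofReal_mul (mul_nonneg hP.le (hz.trans hzz'))]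
  gcongr

end Single

/-! ### Dense-network limits -/

section Limit

variable {k : ℕ} {M : PathLoss k} {Ω : ℝ → Type*} [∀ lam, MeasurableSpace (Ω lam)]
  {μ : ∀ lam, Measure (Ω lam)} [∀ lam, IsProbabilityMeasure (μ lam)]
  {S : ∀ lam, Network (Ω lam)} {q rho : ℝ}

/-- In the limit of a dense network, some link has a path loss close to the largest one. -/
lemma tendsto_measure_no_strong_link (hM : M.Valid)
    (hLoS : ∃ w, M.L < w ∧ M.piece w = 0 ∧ 0 < M.prL 0 w)
    (hS : ∀ lam, 0 < lam → (S lam).Valid (μ lam) q rho lam) {z : ℝ} (hz : z < M.zetaPieceL 0 M.L) :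
    Tendsto (fun lam => μ lam {ω | ∀ i, (S lam).pathLoss M i ω < z}) atTop (𝓝 0) := by
  obtain ⟨ε, hε, p, hp, h⟩ := hM.exists_radius hLoS hz
  have hlim : Tendsto (fun lam : ℝ => nexp (ENNReal.ofReal lam *
      (ENNReal.ofReal p * volume (Metric.ball (0 : Plane) ε)))) atTop (𝓝 0) := by
    rw [← nexp_top]
    refine (continuous_nexp.tendsto _).comp ?_
    have hc : ENNReal.ofReal p * volume (Metric.ball (0 : Plane) ε) ≠ 0 :=
      mul_ne_zero (ENNReal.ofReal_pos.2 hp.1).ne' (Metric.measure_ball_pos _ _ hε).ne'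
    have := ENNReal.Tendsto.mul_const ENNReal.tendsto_ofReal_atTop (Or.inl ENNReal.top_ne_zero)
      (b := ENNReal.ofReal p * volume (Metric.ball (0 : Plane) ε))
    rwa [ENNReal.top_mul hc] at this
  refine tendsto_of_tendsto_of_tendsto_of_le_of_le' tendsto_const_nhds hlim
    (Eventually.of_forall fun _ => zero_le) ?_
  filter_upwards [eventually_gt_atTop 0] with lam hlam
  exact (hS lam hlam).measure_no_strong_link_le hlam.le hp h

/-- In the limit of a dense network, the serving BS is not active. -/
lemma eventually_measure_active_serving_le (hM : M.Valid)
    (hLoS : ∃ w, M.L < w ∧ M.piece w = 0 ∧ 0 < M.prL 0 w)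
    (hdomL : ∀ w, M.L ≤ w → M.zetaL w ≤ M.zetaPieceL 0 M.L)
    (hdomNL : ∀ w, M.L ≤ w → M.zetaNL w ≤ M.zetaPieceL 0 M.L) (hrho : 0 < rho) (hq : 0 < q)
    (hS : ∀ lam, 0 < lam → (S lam).Valid (μ lam) q rho lam) {ε : ℝ≥0∞} (hε : 0 < ε) :
    ∀ᶠ lam in atTop, μ lam {ω | (S lam).active ((S lam).serving M ω) ω} ≤ ε := by
  have hζ : 0 < M.zetaPieceL 0 M.L :=
    mul_pos (hM.AL_pos _) (Real.rpow_pos_of_pos hM.L_pos _)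
  have hε2 : 0 < ε / 2 := ENNReal.half_pos hε.ne'
  have hr : ENNReal.ofReal (rho + 1) ≠ 0 := (ENNReal.ofReal_pos.2 (by linarith)).ne'
  -- The level `z` is fixed before `lam`. The area bound is divided by `rho + 1`, which eventually
  -- dominates the active density.
  obtain ⟨z, hz0, hz, hvol⟩ := hM.exists_volume_strongRegion_le hζ hdomL hdomNL
    (ENNReal.div_pos hε2.ne' (ENNReal.ofReal_ne_top (r := rho + 1)))
  have h1 := (tendsto_measure_no_strong_link hM hLoS hS hz).eventually (gt_mem_nhds hε2)
  have h2 := (tendsto_activeDensity (rho := rho) hq).eventually (gt_mem_nhds (lt_add_one rho))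
  filter_upwards [h1, h2, eventually_gt_atTop 0] with lam h1 h2 hlam
  refine ((hS lam hlam).measure_active_serving_le hM (activeDensity_nonneg hq hrho hlam) hz0).trans ?_
  calc _ ≤ ε / 2 + ENNReal.ofReal (rho + 1) * (ε / 2 / ENNReal.ofReal (rho + 1)) :=
        add_le_add h1.le (mul_le_mul' (ENNReal.ofReal_le_ofReal h2.le) hvol)
    _ = ε := by rw [ENNReal.mul_div_cancel hr ENNReal.ofReal_ne_top, ENNReal.add_halves]

lemma tendsto_lintegral_nexp_interference (hM : M.Valid)
    (hLoS : ∃ w, M.L < w ∧ M.piece w = 0 ∧ 0 < M.prL 0 w)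
    (hdomL : ∀ w, M.L ≤ w → M.zetaL w ≤ M.zetaPieceL 0 M.L)
    (hdomNL : ∀ w, M.L ≤ w → M.zetaNL w ≤ M.zetaPieceL 0 M.L) (hrho : 0 < rho) (hq : 0 < q)
    (hS : ∀ lam, 0 < lam → (S lam).Valid (μ lam) q rho lam) {P s : ℝ} (hP : 0 < P) (hs : 0 < s) :
    Tendsto (fun lam => ∫⁻ ω, nexp (ENNReal.ofReal s * (S lam).interference M P ω) ∂μ lam) atTop
      (𝓝 (nexp (ENNReal.ofReal rho *
        (ENNReal.ofReal (2 * Real.pi) * (M.integralL P s + M.integralNL P s))))) := by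
  have hlim : Tendsto (fun lam => ∫⁻ ω, nexp (ENNReal.ofReal s * (S lam).totalPower M P ω) ∂μ lam)
      atTop (𝓝 (nexp (ENNReal.ofReal rho *
        (ENNReal.ofReal (2 * Real.pi) * (M.integralL P s + M.integralNL P s))))) := by
    refine Tendsto.congr' (f₁ := fun lam => nexp (ENNReal.ofReal (activeDensity q rho lam) *
      (ENNReal.ofReal (2 * Real.pi) * (M.integralL P s + M.integralNL P s)))) ?_ ?_
    · filter_upwards [eventually_gt_atTop 0] with lam hlam
      exact ((hS lam hlam).lintegral_nexp_totalPower hM (activeDensity_nonneg hq hrho hlam)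
        hP hs).symm
    -- Positivity of `rho` excludes the indeterminate product `0 * ∞` when an integral diverges.
    · refine (continuous_nexp.tendsto _).comp (ENNReal.Tendsto.mul_const
        (ENNReal.tendsto_ofReal (tendsto_activeDensity hq))
        (Or.inl (ENNReal.ofReal_pos.2 hrho).ne'))
  refine tendsto_of_le_add hlim (nexp_ne_top _) (fun ε _ => Eventually.of_forall fun lam => ?_)
    fun ε hε => ?_
  · exact (lintegral_mono fun ω => antitone_nexp
      (mul_le_mul_right (interference_le_totalPower _ _ _ _) _)).trans le_self_add
  · filter_upwards [eventually_measure_active_serving_le hM hLoS hdomL hdomNL hrho hq hS hε,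
      eventually_gt_atTop 0] with lam h hlam
    exact ((hS lam hlam).lintegral_nexp_interference_le hM P s).trans (add_le_add_right h _)

lemma tendsto_measure_sinrWith (hM : M.Valid)
    (hLoS : ∃ w, M.L < w ∧ M.piece w = 0 ∧ 0 < M.prL 0 w)
    (hdomL : ∀ w, M.L ≤ w → M.zetaL w ≤ M.zetaPieceL 0 M.L)
    (hdomNL : ∀ w, M.L ≤ w → M.zetaNL w ≤ M.zetaPieceL 0 M.L) (hrho : 0 < rho) (hq : 0 < q)
    (hS : ∀ lam, 0 < lam → (S lam).Valid (μ lam) q rho lam) {P PN g : ℝ} (hP : 0 < P)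
    (hg : 0 < g) :
    Tendsto (fun lam => μ lam
        {ω | ENNReal.ofReal g < (S lam).sinrWith M P PN (M.zetaPieceL 0 M.L) ω}) atTop
      (𝓝 (nexp (ENNReal.ofReal (g / (P * M.zetaPieceL 0 M.L)) * ENNReal.ofReal PN) *
        nexp (ENNReal.ofReal rho * (ENNReal.ofReal (2 * Real.pi) *
          (M.integralL P (g / (P * M.zetaPieceL 0 M.L)) +
            M.integralNL P (g / (P * M.zetaPieceL 0 M.L))))))) := by
  have hζ : 0 < M.zetaPieceL 0 M.L :=
    mul_pos (hM.AL_pos _) (Real.rpow_pos_of_pos hM.L_pos _)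
  have h := ENNReal.Tendsto.const_mul (tendsto_lintegral_nexp_interference hM hLoS hdomL hdomNL
    hrho hq hS hP (div_pos hg (mul_pos hP hζ)))
    (Or.inr (nexp_ne_top (ENNReal.ofReal (g / (P * M.zetaPieceL 0 M.L)) * ENNReal.ofReal PN)))
  refine h.congr' ?_
  filter_upwards [eventually_gt_atTop 0] with lam hlam
  have hV := hS lam hlam
  rw [hV.measure_lt_sinrWith hM hP hζ hg, ← lintegral_const_mul']
  · refine lintegral_congr fun ω => ?_
    rw [← nexp_add, ← mul_add, add_comm (ENNReal.ofReal PN)]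
  · exact nexp_ne_top _

/-- Lowering the serving path loss from `ζ` to `z` rescales the exponent by `ζ / z`, hence the last
error term. After that the true path loss is at least `z` unless no link reaches `z`. -/
lemma measure_sinrWith_le_measure_sinr_add {Ω : Type*} [MeasurableSpace Ω] {μ : Measure Ω}
    [IsProbabilityMeasure μ] {S : Network Ω} {lam : ℝ} (hS : S.Valid μ q rho lam) (hM : M.Valid)
    {P PN g z ζ : ℝ} (hP : 0 < P) (hg : 0 < g) (hz : 0 < z) (hzζ : z ≤ ζ) :
    μ {ω | ENNReal.ofReal g < S.sinrWith M P PN ζ ω} ≤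
      μ {ω | ENNReal.ofReal g < S.sinr M P PN ω} + μ {ω | ∀ i, S.pathLoss M i ω < z}
        + ENNReal.ofReal (ζ / z - 1) := by
  have hζ : 0 < ζ := hz.trans_le hzζ
  have h1 : μ {ω | ENNReal.ofReal g < S.sinrWith M P PN ζ ω} ≤
      μ {ω | ENNReal.ofReal g < S.sinrWith M P PN z ω} + ENNReal.ofReal (ζ / z - 1) := by
    rw [hS.measure_lt_sinrWith hM hP hζ hg, hS.measure_lt_sinrWith hM hP hz hg]
    calc _ ≤ ∫⁻ ω, (nexp (ENNReal.ofReal (g / (P * z)) *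
          (S.interference M P ω + ENNReal.ofReal PN)) + ENNReal.ofReal (ζ / z - 1)) ∂μ := by
          refine lintegral_mono fun ω => ?_
          have ht : 1 ≤ ζ / z := (one_le_div hz).2 hzζ
          refine (nexp_le_nexp_mul_add ht _).trans_eq ?_
          rw [← mul_assoc, ← ENNReal.ofReal_mul (by positivity)]
          congr 4
          field_simp
      _ = _ := by rw [lintegral_add_right _ measurable_const]; simp
  refine h1.trans (add_le_add_left ?_ _)
  refine le_trans (measure_mono_ae ?_) (measure_union_le _ _)
  filter_upwards [hS.ae_le_pathLoss_serving hM hz] with ω hω hcov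
  by_cases h : ∃ i, z ≤ S.pathLoss M i ω
  · exact Or.inl (lt_of_lt_of_le hcov (sinrWith_mono S M hP PN hz.le (hω h) ω))
  · exact Or.inr fun i => not_le.1 fun hi => h ⟨i, hi⟩

lemma measure_sinr_le_measure_sinrWith {Ω : Type*} [MeasurableSpace Ω] (μ : Measure Ω)
    (S : Network Ω) (hM : M.Valid) {P ζ : ℝ} (hP : 0 < P) (PN g : ℝ)
    (hdomL : ∀ w, M.L ≤ w → M.zetaL w ≤ ζ) (hdomNL : ∀ w, M.L ≤ w → M.zetaNL w ≤ ζ) :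
    μ {ω | ENNReal.ofReal g < S.sinr M P PN ω} ≤
      μ {ω | ENNReal.ofReal g < S.sinrWith M P PN ζ ω} := by
  refine measure_mono fun ω hω => lt_of_lt_of_le hω (sinrWith_mono S M hP PN ?_ ?_ ω)
  · exact (hM.gain_pos _ _).le
  · rw [pathLoss_eq, PathLoss.gain]
    split_ifs
    exacts [hdomL _ (M.le_dist3 _), hdomNL _ (M.le_dist3 _)]

end Limit

end Network

end UDN

/-! ### Assembly of the limits -/

theorem theorem1 {k : ℕ} (M : UDN.PathLoss k) (hM : M.Valid)
    -- a link at the beginning of the first piece can be LoS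
    (hLoS : ∃ w, M.L < w ∧ M.piece w = 0 ∧ 0 < M.prL 0 w)
    -- no link is stronger than a first-piece LoS link at the smallest 3D distance `L`
    (hdomL : ∀ w, M.L ≤ w → M.zetaL w ≤ M.zetaPieceL 0 M.L)
    (hdomNL : ∀ w, M.L ≤ w → M.zetaNL w ≤ M.zetaPieceL 0 M.L)
    (P PN rho q g s : ℝ) (hP : 0 < P) (hPN : 0 ≤ PN) (hrho : 0 < rho) (hq : 0 < q) (hg : 0 < g)
    (hs : s = g / (P * M.zetaPieceL 0 M.L))
    (Ω : ℝ → Type*) [∀ lam, MeasurableSpace (Ω lam)]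
    (μ : ∀ lam, Measure (Ω lam)) [∀ lam, IsProbabilityMeasure (μ lam)]
    (S : ∀ lam, UDN.Network (Ω lam)) (hS : ∀ lam, 0 < lam → (S lam).Valid (μ lam) q rho lam) :
    Tendsto (fun lam => UDN.activeDensity q rho lam) atTop (𝓝 rho) ∧
    Tendsto (fun lam => (S lam).laplace M (μ lam) P s) atTop (𝓝 (M.limitLaplace P rho s)) ∧
    Tendsto (fun lam => (μ lam).real
        {ω | ENNReal.ofReal g < (S lam).sinrWith M P PN (M.zetaPieceL 0 M.L) ω}) atTop
      (𝓝 (Real.exp (-(PN * g / (P * M.zetaPieceL 0 M.L))) * M.limitLaplace P rho s)) ∧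
    Tendsto (fun lam => (S lam).pcov M (μ lam) P PN g) atTop
      (𝓝 (Real.exp (-(PN * g / (P * M.zetaPieceL 0 M.L))) * M.limitLaplace P rho s)) := by
  have hζ : 0 < M.zetaPieceL 0 M.L :=
    mul_pos (hM.AL_pos _) (Real.rpow_pos_of_pos hM.L_pos _)
  have hs0 : 0 < s := hs ▸ div_pos hg (mul_pos hP hζ)
  have hsinr := UDN.Network.tendsto_measure_sinrWith (PN := PN) hM hLoS hdomL hdomNL hrho hq hS hP hg
  rw [← hs] at hsinr
  have hne : UDN.nexp (ENNReal.ofReal s * ENNReal.ofReal PN) *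
      UDN.nexp (ENNReal.ofReal rho * (ENNReal.ofReal (2 * Real.pi) *
        (M.integralL P s + M.integralNL P s))) ≠ ∞ :=
    ENNReal.mul_ne_top (UDN.nexp_ne_top _) (UDN.nexp_ne_top _)
  have hval : Real.exp (-(PN * g / (P * M.zetaPieceL 0 M.L))) * M.limitLaplace P rho s
      = (UDN.nexp (ENNReal.ofReal s * ENNReal.ofReal PN) *
        UDN.nexp (ENNReal.ofReal rho * (ENNReal.ofReal (2 * Real.pi) *
          (M.integralL P s + M.integralNL P s)))).toReal := by
    rw [ENNReal.toReal_mul, ← M.limitLaplace_eq P s hrho.le, ← ENNReal.ofReal_mul hs0.le,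
      UDN.nexp_coe_real _ (mul_nonneg hs0.le hPN), ENNReal.toReal_ofReal (Real.exp_pos _).le, hs]
    ring_nf
  rw [hval]
  refine ⟨UDN.tendsto_activeDensity hq, ?_, ?_, ?_⟩
  · rw [M.limitLaplace_eq P s hrho.le]
    refine Tendsto.congr' ?_ ((ENNReal.tendsto_toReal (UDN.nexp_ne_top _)).comp
      (UDN.Network.tendsto_lintegral_nexp_interference hM hLoS hdomL hdomNL hrho hq hS hP hs0))
    filter_upwards [eventually_gt_atTop 0] with lam hlam
    exact ((hS lam hlam).laplace_eq hM P s).symm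
  · exact (ENNReal.tendsto_toReal hne).comp hsinr
  · refine (ENNReal.tendsto_toReal hne).comp (UDN.tendsto_of_le_add hsinr hne (fun ε hε => ?_)
      fun ε _ => Eventually.of_forall fun lam => ?_)
    · have hε2 : 0 < ε / 2 := ENNReal.half_pos hε.ne'
      -- The level `z` is taken so close to the maximum that the perturbation error is below `ε /
      -- 2`; the density then grows with `z` fixed.
      have hlim : Tendsto (fun z => ENNReal.ofReal (M.zetaPieceL 0 M.L / z - 1))
          (𝓝[<] M.zetaPieceL 0 M.L) (𝓝 0) := by
        have hc : ContinuousAt (fun z => ENNReal.ofReal (M.zetaPieceL 0 M.L / z - 1))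
            (M.zetaPieceL 0 M.L) :=
          ENNReal.continuous_ofReal.continuousAt.comp
            ((continuousAt_const.div continuousAt_id hζ.ne').sub continuousAt_const)
        have := hc.tendsto
        rw [div_self hζ.ne', sub_self, ENNReal.ofReal_zero] at this
        exact this.mono_left nhdsWithin_le_nhds
      obtain ⟨z, ⟨hzε, hzζ⟩, hz0⟩ := ((hlim.eventually (gt_mem_nhds hε2)).and
        self_mem_nhdsWithin).and (nhdsWithin_le_nhds (lt_mem_nhds hζ)) |>.exists
      filter_upwards [eventually_gt_atTop 0, (UDN.Network.tendsto_measure_no_strong_link hM hLoS hS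
        hzζ).eventually (gt_mem_nhds hε2)] with lam hlam hbad
      refine (UDN.Network.measure_sinrWith_le_measure_sinr_add (hS lam hlam) hM hP hg hz0
        (le_of_lt hzζ)).trans ?_
      rw [add_assoc]
      exact add_le_add_right ((add_le_add hbad.le hzε.le).trans_eq (ENNReal.add_halves ε)) _
    · exact (UDN.Network.measure_sinr_le_measure_sinrWith _ _ hM hP PN g hdomL hdomNL).trans
        le_self_add
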